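/- **Theorem (Pure point spectrum case).** Let $r\ge 0$ and, for $j=1,\dots,r$, let $X_j$ be a (possibly unbounded) normal operator on a complex Hilbert space $\mathcal H_j$ (in particular $X_j$ may be self-adjoint; separability is not needed). Assume that each $X_j$ has pure point spectrum: either its spectrum is a countable set $\sigma(X_j)=\{\lambda_{j,k}\}_k$, or the eigenvectors of $X_j$ span a dense subspace of $\mathcal H_j$. For $\lambda\in\mathbb C$ let $P_{X_j}(\lambda)$ be the orthogonal projection onto $\ker(X_j-\lambda)$. Let $f$ be any complex-valued function on $\mathbb C^r$ (only its values on $\sigma(X_1)\times\cdots\times\sigma(X_r)$ matter; for instance $f$ may be holomorphic or Borel near this set). Let $\mathcal H_\otimes=\mathcal H_1\otimes\cdots\otimes\mathcal H_r$ be the Hilbert space tensor product, and let $\widetilde X_j$ be the closure of $I\otimes\cdots\otimes X_j\otimes\cdots\otimes I$. A *projector–nilpotent decomposition* of $(\widetilde X_1,\dots,\widetilde X_r)$ consists of a (projection-valued) spectral measure $E$ on $\mathbb C^r$ acting on $\mathcal H_\otimes$ and of bounded nilpotent operators $N_1,\dots,N_r$ on $\mathcal H_\otimes$, commuting with each other and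 with $E$, such that $\widetilde X_j=\int z_j\,dE(z)+N_j$ for all $j$. The tensor-lifted functional calculus is $f_\otimes(X_1,\dots,X_r):=f(\widetilde X_1,\dots,\widetilde X_r)$, given by the unified compact formula $$f(\widetilde X_1,\dots,\widetilde X_r)=\sum_{A\subseteq\{1,\dots,r\}}\ \sum_{\substack{(q_j)_{j\in A}\\ 1\le q_j\le\nu_j-1}}\Big(\int\frac{\partial_A^{q_A}f(z)}{\prod_{j\in A}q_j!}\,dE(z)\Big)\prod_{j\in A}N_j^{q_j}$$ on its natural domain, where $\nu_j$ is the nilpotency index of $N_j$ and $\partial_A^{q_A}=\prod_{j\in A}\partial^{q_j}/\partial z_j^{q_j}$. Then a projector–nilpotent decomposition of $(\widetilde X_1,\dots,\widetilde X_r)$ exists; in every such decomposition all nilpotent components vanish, $N_j=0$; the operator $f_\otimes(X_1,\dots,X_r)$ is well defined (it does not depend on the decomposition); and $$f_\otimes(X_1,\dots,X_r)=\sum_{\lambda_1\in\sigma(X_1)}\cdots\sum_{\lambda_r\in\sigma(X_r)}f(\lambda_1,\dots,\lambda_r)\,P_{X_1}(\lambda_1)\otimes\cdots\otimes P_{X_r}(\lambda_r).$$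 The last equation is an equality of (possibly unbounded) operators: $u\in\mathcal H_\otimes$ lies in the domain of $f_\otimes(X_1,\dots,X_r)$ and is mapped to $w$ if and only if the series $\sum_{(\lambda_1,\dots,\lambda_r)}f(\lambda_1,\dots,\lambda_r)\,\big(P_{X_1}(\lambda_1)\otimes\cdots\otimes P_{X_r}(\lambda_r)\big)u$ converges unconditionally to $w$. -/

import Mathlib

noncomputable section

namespace TensorCalculus

open scoped TensorProduct ComplexConjugate ComplexOrder
open MeasureTheory Filter Topology

section Tensor

variable {r : ℕ} (H : Fin r → Type*) [∀ j, NormedAddCommGroup (H j)]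
  [∀ j, InnerProductSpace ℂ (H j)]

/-- The algebraic tensor product of the `H j`, without any norm. -/
def AlgTensor : Type _ := ⨂[ℂ] j, H j

instance : AddCommGroup (AlgTensor H) := inferInstanceAs (AddCommGroup (⨂[ℂ] j, H j))
instance : Module ℂ (AlgTensor H) := inferInstanceAs (Module ℂ (⨂[ℂ] j, H j))

variable {H}

/-- The multilinear form `v ↦ ∏ j, ⟪u j, v j⟫`. -/
def innerProd (u : ∀ j, H j) : MultilinearMap ℂ H ℂ :=
  (MultilinearMap.mkPiAlgebra ℂ (Fin r) ℂ).compLinearMap fun j => innerₛₗ ℂ (u j)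

lemma innerProd_apply (u v : ∀ j, H j) : innerProd u v = ∏ j, inner ℂ (u j) (v j) := rfl

/-- The linear functional on the algebraic tensor product with `⊗ v ↦ ∏ j, ⟪u j, v j⟫`. -/
def innerLift (u : ∀ j, H j) : AlgTensor H →ₗ[ℂ] ℂ := PiTensorProduct.lift (innerProd u)

/-- Pure tensors in the algebraic tensor product. -/
def algTprod : MultilinearMap ℂ H (AlgTensor H) := PiTensorProduct.tprod ℂ

lemma innerLift_tprod (u v : ∀ j, H j) :
    innerLift u (algTprod v) = ∏ j, inner ℂ (u j) (v j) :=
  PiTensorProduct.lift.tprod _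

lemma algTensor_induction {p : AlgTensor H → Prop} (t : AlgTensor H)
    (h1 : ∀ (c : ℂ) u, p (c • algTprod u)) (h2 : ∀ s t, p s → p t → p (s + t)) : p t :=
  PiTensorProduct.induction_on t h1 h2

lemma innerLift_update_add (u : ∀ j, H j) (i : Fin r) (x y : H i) (t : AlgTensor H) :
    innerLift (Function.update u i (x + y)) t =
      innerLift (Function.update u i x) t + innerLift (Function.update u i y) t := by
  induction t using algTensor_induction with
  | h1 c v =>
    simp only [map_smul, innerLift_tprod, ← smul_add]
    congr 1
    have h (z : H i) : ∏ j, inner ℂ (Function.update u i z j) (v j) =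
        inner ℂ z (v i) * ∏ j ∈ Finset.univ.erase i, inner ℂ (u j) (v j) := by
      rw [← Finset.mul_prod_erase _ _ (Finset.mem_univ i)]
      congr 1
      · simp
      · exact Finset.prod_congr rfl fun j hj => by
          rw [Function.update_of_ne (Finset.ne_of_mem_erase hj)]
    rw [h, h, h, inner_add_left, add_mul]
  | h2 s t hs ht => simp only [map_add, hs, ht]; ring

lemma innerLift_update_smul (u : ∀ j, H j) (i : Fin r) (c : ℂ) (x : H i) (t : AlgTensor H) :
    innerLift (Function.update u i (c • x)) t =
      conj c * innerLift (Function.update u i x) t := by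
  induction t using algTensor_induction with
  | h1 d v =>
    simp only [map_smul, innerLift_tprod, smul_eq_mul]
    have h (z : H i) : ∏ j, inner ℂ (Function.update u i z j) (v j) =
        inner ℂ z (v i) * ∏ j ∈ Finset.univ.erase i, inner ℂ (u j) (v j) := by
      rw [← Finset.mul_prod_erase _ _ (Finset.mem_univ i)]
      congr 1
      · simp
      · exact Finset.prod_congr rfl fun j hj => by
          rw [Function.update_of_ne (Finset.ne_of_mem_erase hj)]
    rw [h, h, inner_smul_left]; ring
  | h2 s t hs ht => simp only [map_add, hs, ht]; ring

/-- The sesquilinear form of the tensor product, linear in the first (outer) argument. -/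
def innerForm : AlgTensor H →ₗ[ℂ] AlgTensor H →ₛₗ[starRingEnd ℂ] ℂ :=
  PiTensorProduct.lift
    { toFun := fun v =>
        { toFun := fun t => conj (innerLift v t)
          map_add' := fun s t => by simp
          map_smul' := fun c t => by simp }
      map_update_add' := fun v i x y => by
        ext t
        have := @innerLift_update_add r H _ _ v i x y t
        simp only [LinearMap.coe_mk, AddHom.coe_mk, LinearMap.add_apply]
        rw [← map_add]; congr 1; convert this
      map_update_smul' := fun v i c x => by
        ext t
        have := @innerLift_update_smul r H _ _ v i c x t
        simp only [LinearMap.coe_mk, AddHom.coe_mk, LinearMap.smul_apply, smul_eq_mul]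
        rw [← Complex.conj_conj c, ← map_mul, Complex.conj_conj]; congr 1; convert this }

lemma innerForm_tprod (v : ∀ j, H j) (t : AlgTensor H) :
    innerForm (algTprod v) t = conj (innerLift v t) := by
  have : innerForm (algTprod v) = _ := PiTensorProduct.lift.tprod v
  rw [this]; rfl

lemma innerForm_tprod_tprod (u v : ∀ j, H j) :
    innerForm (algTprod v) (algTprod u) = ∏ j, inner ℂ (u j) (v j) := by
  rw [innerForm_tprod, innerLift_tprod, map_prod]
  exact Finset.prod_congr rfl fun j _ => inner_conj_symm _ _

lemma exists_finsupp (t : AlgTensor H) :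
    ∃ x : (∀ j, H j) →₀ ℂ, t = x.sum fun u c => c • algTprod u := by
  induction t using algTensor_induction with
  | h1 c u => exact ⟨Finsupp.single u c, by simp⟩
  | h2 s t hs ht =>
    obtain ⟨x, rfl⟩ := hs
    obtain ⟨y, rfl⟩ := ht
    classical
    exact ⟨x + y, by rw [Finsupp.sum_add_index'] <;> simp [add_smul]⟩

set_option linter.unusedSectionVars false in
lemma innerForm_finsupp (x : (∀ j, H j) →₀ ℂ) {G : Fin r → Type*}
    [∀ j, NormedAddCommGroup (G j)] [∀ j, InnerProductSpace ℂ (G j)]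
    (g : (∀ j, H j) → ∀ j, G j) :
    innerForm (x.sum fun u c => c • algTprod (g u)) (x.sum fun u c => c • algTprod (g u)) =
      x.sum fun u c => x.sum fun v d => star c * (∏ j, inner ℂ (g u j) (g v j)) * d := by
  simp only [Finsupp.sum, map_sum, LinearMap.sum_apply, map_smul, LinearMap.smul_apply,
    map_smulₛₗ, innerForm_tprod_tprod, smul_eq_mul]
  refine Finset.sum_congr rfl fun u _ => ?_
  rw [Finset.mul_sum]
  refine Finset.sum_congr rfl fun v _ => ?_
  rw [starRingEnd_apply]; ring

lemma inner_self_eq_ofReal {E : Type*} [SeminormedAddCommGroup E] [InnerProductSpace ℂ E] (y : E) :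
    inner ℂ y y = ((‖y‖ ^ 2 : ℝ) : ℂ) := by
  rw [inner_self_eq_norm_sq_to_K]; push_cast; rfl

lemma sum_gram {n E : Type*} [NormedAddCommGroup E] [InnerProductSpace ℂ E] (g : n → E)
    (x : n →₀ ℂ) : (x.sum fun a c => x.sum fun b d => star c * inner ℂ (g a) (g b) * d) =
      ((‖x.sum fun a c => c • g a‖ ^ 2 : ℝ) : ℂ) := by
  rw [← inner_self_eq_ofReal]
  simp only [Finsupp.sum, sum_inner, inner_sum, inner_smul_left, inner_smul_right,
    starRingEnd_apply]
  rw [Finset.sum_comm]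
  refine Finset.sum_congr rfl fun a _ => ?_
  rw [Finset.mul_sum]
  refine Finset.sum_congr rfl fun b _ => ?_
  ring

lemma posSemidef_kernel {n E : Type*} [NormedAddCommGroup E] [InnerProductSpace ℂ E]
    (g : n → E) : (Matrix.of fun a b => inner ℂ (g a) (g b)).PosSemidef := by
  refine ⟨?_, fun x => ?_⟩
  · ext a b; simp [Matrix.conjTranspose_apply]
  · simp only [Matrix.of_apply]
    rw [sum_gram]
    exact Complex.zero_le_real.2 (sq_nonneg _)

lemma posSemidef_kernel_sub {n E F : Type*} [NormedAddCommGroup E] [InnerProductSpace ℂ E]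
    [NormedAddCommGroup F] [InnerProductSpace ℂ F] (g : n → E) (A : E →L[ℂ] F) :
    ((Matrix.of fun a b => (‖A‖ : ℂ) ^ 2 * inner ℂ (g a) (g b)) -
      Matrix.of fun a b => inner ℂ (A (g a)) (A (g b))).PosSemidef := by
  refine ⟨?_, fun x => ?_⟩
  · ext a b; simp [Matrix.conjTranspose_apply]
  · have h : (x.sum fun a c => x.sum fun b d => star c *
        (((Matrix.of fun a b => (‖A‖ : ℂ) ^ 2 * inner ℂ (g a) (g b)) -
          Matrix.of fun a b => inner ℂ (A (g a)) (A (g b))) a b) * d) =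
        (‖A‖ : ℂ) ^ 2 * (x.sum fun a c => x.sum fun b d => star c * inner ℂ (g a) (g b) * d) -
          x.sum fun a c => x.sum fun b d => star c * inner ℂ (A (g a)) (A (g b)) * d := by
      simp only [Finsupp.sum, Finset.mul_sum, ← Finset.sum_sub_distrib, Matrix.sub_apply,
        Matrix.of_apply]
      exact Finset.sum_congr rfl fun a _ => Finset.sum_congr rfl fun b _ => by ring
    rw [h, sum_gram, sum_gram (fun a => A (g a))]
    have h2 : (x.sum fun a c => c • A (g a)) = A (x.sum fun a c => c • g a) := by
      simp [Finsupp.sum, map_sum]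
    rw [h2, sub_nonneg]
    have := A.le_opNorm (x.sum fun a c => c • g a)
    have h3 := pow_le_pow_left₀ (norm_nonneg _) this 2
    rw [mul_pow] at h3
    exact_mod_cast h3

/-- Entrywise products of positive semidefinite kernels are positive semidefinite and monotone. -/
lemma posSemidef_prod {n : Type*} (A B : Fin r → Matrix n n ℂ) (hA : ∀ j, (A j).PosSemidef)
    (hB : ∀ j, (B j - A j).PosSemidef) (s : Finset (Fin r)) :
    (Matrix.of fun a b => ∏ j ∈ s, A j a b).PosSemidef ∧
      (Matrix.of fun a b => ∏ j ∈ s, B j a b - ∏ j ∈ s, A j a b).PosSemidef := by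
  classical
  induction s using Finset.induction_on with
  | empty =>
    constructor
    · refine ⟨by ext; simp, fun x => ?_⟩
      have : (x.sum fun i xi => x.sum fun j xj => star xi *
          (Matrix.of fun a b => ∏ j ∈ (∅ : Finset (Fin r)), A j a b) i j * xj) =
          star (x.sum fun _ c => c) * (x.sum fun _ c => c) := by
        simp [Finsupp.sum, Finset.sum_mul_sum]
      rw [this]
      exact star_mul_self_nonneg _
    · have : (Matrix.of fun a b => ∏ j ∈ (∅ : Finset (Fin r)), B j a b -
          ∏ j ∈ (∅ : Finset (Fin r)), A j a b) = (0 : Matrix n n ℂ) := by ext; simp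
      rw [this]; exact Matrix.PosSemidef.zero
  | insert i s hi ih =>
    have h1 := (hA i).hadamard ih.1
    have hBi : (B i).PosSemidef := by simpa using (hB i).add (hA i)
    have h2 := (hBi.hadamard ih.2).add ((hB i).hadamard ih.1)
    constructor
    · have : (Matrix.of fun a b => ∏ j ∈ insert i s, A j a b) =
          (A i).hadamard (Matrix.of fun a b => ∏ j ∈ s, A j a b) := by
        ext a b; simp [Finset.prod_insert hi]
      rw [this]; exact h1
    · have : (Matrix.of fun a b => ∏ j ∈ insert i s, B j a b - ∏ j ∈ insert i s, A j a b) =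
          (B i).hadamard (Matrix.of fun a b => ∏ j ∈ s, B j a b - ∏ j ∈ s, A j a b) +
            (B i - A i).hadamard (Matrix.of fun a b => ∏ j ∈ s, A j a b) := by
        ext a b; simp [Finset.prod_insert hi]; ring
      rw [this]; exact h2

/-- The inner product `⟪⊗ u, ⊗ v⟫ = ∏ j, ⟪u j, v j⟫` on the algebraic tensor product. -/
abbrev algCore : PreInnerProductSpace.Core ℂ (AlgTensor H) where
  inner s t := innerForm t s
  conj_inner_symm s t := by
    induction s using algTensor_induction with
    | h1 c u =>
      induction t using algTensor_induction with
      | h1 d v =>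
        simp only [map_smul, LinearMap.smul_apply, map_smulₛₗ, innerForm_tprod_tprod, smul_eq_mul,
          map_mul, map_prod, inner_conj_symm, Complex.conj_conj]
        ring
      | h2 s t hs ht => simp only [map_add, LinearMap.add_apply, hs, ht]
    | h2 s t hs ht => simp only [map_add, LinearMap.add_apply, hs, ht]
  re_inner_nonneg t := by
    obtain ⟨x, rfl⟩ := exists_finsupp t
    rw [innerForm_finsupp x fun u => u]
    have := (posSemidef_prod (fun j => Matrix.of fun u v : ∀ j, H j => inner ℂ (u j) (v j))
      (fun j => Matrix.of fun u v : ∀ j, H j => inner ℂ (u j) (v j))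
      (fun j => posSemidef_kernel _)
      (fun j => by rw [sub_self]; exact Matrix.PosSemidef.zero) Finset.univ).1.2 x
    exact (RCLike.le_iff_re_im.1 this).1
  add_left s t u := by simp
  smul_left s t c := by simp

instance : SeminormedAddCommGroup (AlgTensor H) :=
  letI := algCore (H := H)
  InnerProductSpace.Core.toSeminormedAddCommGroup (𝕜 := ℂ)

instance : InnerProductSpace ℂ (AlgTensor H) := InnerProductSpace.ofCore algCore

lemma alg_inner_def (s t : AlgTensor H) : inner ℂ s t = innerForm t s := rfl

variable (H) in
/-- The Hilbert space tensor product `H 0 ⊗ ⋯ ⊗ H (r - 1)`. -/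
abbrev HilbertTensor : Type _ := UniformSpace.Completion (AlgTensor H)

/-- The elementary tensor `u 0 ⊗ ⋯ ⊗ u (r - 1)`. -/
def elem (u : ∀ j, H j) : HilbertTensor H := ((algTprod u : AlgTensor H) : HilbertTensor H)

lemma inner_elem (u v : ∀ j, H j) :
    inner ℂ (elem u) (elem v) = ∏ j, inner ℂ (u j) (v j) := by
  rw [elem, elem, UniformSpace.Completion.inner_coe, alg_inner_def, innerForm_tprod_tprod]

/-- The algebraic tensor product of bounded operators. -/
def algMap (A : ∀ j, H j →L[ℂ] H j) : AlgTensor H →ₗ[ℂ] AlgTensor H :=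
  PiTensorProduct.map fun j => (A j : H j →ₗ[ℂ] H j)

lemma algMap_tprod (A : ∀ j, H j →L[ℂ] H j) (u : ∀ j, H j) :
    algMap A (algTprod u) = algTprod fun j => A j (u j) :=
  PiTensorProduct.map_tprod _ _

lemma norm_algMap_le (A : ∀ j, H j →L[ℂ] H j) (t : AlgTensor H) :
    ‖algMap A t‖ ≤ (∏ j, ‖A j‖) * ‖t‖ := by
  refine le_of_sq_le_sq ?_ (by positivity)
  obtain ⟨x, rfl⟩ := exists_finsupp t
  have h := (posSemidef_prod
      (fun j => Matrix.of fun u v : ∀ j, H j => inner ℂ (A j (u j)) (A j (v j)))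
      (fun j => Matrix.of fun u v : ∀ j, H j => (‖A j‖ : ℂ) ^ 2 * inner ℂ (u j) (v j))
      (fun j => posSemidef_kernel _)
      (fun j => posSemidef_kernel_sub _ _) Finset.univ).2.2 x
  have e1 := innerForm_finsupp x fun u j => A j (u j)
  have e2 := innerForm_finsupp x fun u => u
  have e3 : algMap A (x.sum fun u c => c • algTprod u) =
      x.sum fun u c => c • algTprod fun j => A j (u j) := by
    simp [Finsupp.sum, map_sum, algMap_tprod]
  have e4 : (x.sum fun u c => x.sum fun v d => star c *
      ((Matrix.of fun u v : ∀ j, H j => ∏ j, (Matrix.of fun u v : ∀ j, H j =>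
        (‖A j‖ : ℂ) ^ 2 * inner ℂ (u j) (v j)) u v - ∏ j, (Matrix.of fun u v : ∀ j, H j =>
        inner ℂ (A j (u j)) (A j (v j))) u v) u v) * d) =
      (∏ j, (‖A j‖ : ℂ)) ^ 2 *
        (x.sum fun u c => x.sum fun v d => star c * (∏ j, inner ℂ (u j) (v j)) * d) -
      x.sum fun u c => x.sum fun v d =>
        star c * (∏ j, inner ℂ (A j (u j)) (A j (v j))) * d := by
    simp only [Finsupp.sum, Finset.mul_sum, ← Finset.sum_sub_distrib, Matrix.of_apply,
      Finset.prod_mul_distrib, Finset.prod_pow]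
    exact Finset.sum_congr rfl fun a _ => Finset.sum_congr rfl fun b _ => by ring
  rw [e4, ← e1, ← e2, ← e3, ← alg_inner_def, ← alg_inner_def, inner_self_eq_ofReal,
    inner_self_eq_ofReal, sub_nonneg] at h
  rw [mul_pow]
  exact_mod_cast h

/-- The bounded operator `A 0 ⊗ ⋯ ⊗ A (r - 1)`. -/
def tensorMap (A : ∀ j, H j →L[ℂ] H j) : HilbertTensor H →L[ℂ] HilbertTensor H :=
  ((algMap A).mkContinuous (∏ j, ‖A j‖) (norm_algMap_le A)).completion

lemma tensorMap_elem (A : ∀ j, H j →L[ℂ] H j) (u : ∀ j, H j) :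
    tensorMap A (elem u) = elem fun j => A j (u j) := by
  rw [tensorMap, elem, ContinuousLinearMap.completion_apply_coe, elem,
    LinearMap.mkContinuous_apply, algMap_tprod]

/-- The graph of `I ⊗ ⋯ ⊗ X ⊗ ⋯ ⊗ I` (with `X` in slot `j`) on the algebraic tensor product: the
span of the pairs `(u 0 ⊗ ⋯ ⊗ u j ⊗ ⋯ ⊗ u (r - 1), u 0 ⊗ ⋯ ⊗ X (u j) ⊗ ⋯ ⊗ u (r - 1))` with
`u j ∈ D(X)`. -/
def liftGraph (j : Fin r) (X : H j →ₗ.[ℂ] H j) : Submodule ℂ (HilbertTensor H × HilbertTensor H) :=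
  Submodule.span ℂ {p | ∃ (u : ∀ i, H i) (y : H j), (u j, y) ∈ X.graph ∧
    p = (elem u, elem (Function.update u j y))}

/-- The lifted operator `X̃_j = I ⊗ ⋯ ⊗ X ⊗ ⋯ ⊗ I` (with `X` in slot `j`): the closure of the
operator on the algebraic tensor product. -/
def lift (j : Fin r) (X : H j →ₗ.[ℂ] H j) : HilbertTensor H →ₗ.[ℂ] HilbertTensor H :=
  (liftGraph j X).topologicalClosure.toLinearPMap

end Tensor

section Operator

variable {H : Type*} [NormedAddCommGroup H] [InnerProductSpace ℂ H] [CompleteSpace H]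

open scoped LinearPMap

/-- A (possibly unbounded) normal operator: closed, densely defined, `D(X) = D(X†)` and
`‖X u‖ = ‖X† u‖` on this common domain. -/
structure IsNormalOp (X : H →ₗ.[ℂ] H) : Prop where
  dense : Dense (X.domain : Set H)
  closed : X.IsClosed
  domain_eq : X.domain = X†.domain
  norm_eq : ∀ (u : X.domain) (v : X†.domain), (u : H) = v → ‖X u‖ = ‖X† v‖

/-- Self-adjoint operators are normal. -/
theorem _root_.IsSelfAdjoint.isNormalOp {X : H →ₗ.[ℂ] H} (hX : IsSelfAdjoint X) :
    IsNormalOp X where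
  dense := hX.dense_domain
  closed := hX.isClosed
  domain_eq := congrArg LinearPMap.domain (LinearPMap.isSelfAdjoint_def.1 hX).symm
  norm_eq u v huv := by
    have h : X† ≤ X := (LinearPMap.isSelfAdjoint_def.1 hX).le
    rw [h.2 huv.symm]

/-- The spectrum of a (possibly unbounded) operator: those `z` for which `X - z : D(X) → H` has no
bounded everywhere defined two-sided inverse `R`. -/
def opSpectrum (X : H →ₗ.[ℂ] H) : Set ℂ :=
  {z | ¬ ∃ R : H →L[ℂ] H, (∀ v, (R v, v + z • R v) ∈ X.graph) ∧
    ∀ u : X.domain, R (X u - z • (u : H)) = u}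

/-- The eigenspace `ker (X - z)`. -/
def opEigenspace (X : H →ₗ.[ℂ] H) (z : ℂ) : Submodule ℂ H :=
  X.graph.comap (LinearMap.prod LinearMap.id (z • LinearMap.id))

/-- The orthogonal projection `P_X(z)` onto the eigenspace `ker (X - z)`, which is a closed
subspace whenever `X` is closed. -/
def eigenProj (X : H →ₗ.[ℂ] H) (z : ℂ) : H →L[ℂ] H :=
  (opEigenspace X z).topologicalClosure.starProjection

/-- Pure point spectrum. Either the spectrum can be listed as `{λ_k}`, or (the other usual meaning,
which allows eigenvalues to accumulate at an uncountable set) the eigenvectors span a dense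
subspace. -/
def HasPurePointSpectrum (X : H →ₗ.[ℂ] H) : Prop :=
  (opSpectrum X).Countable ∨ (⨆ z, opEigenspace X z).topologicalClosure = ⊤

end Operator

section LiftWellDefined

open scoped LinearPMap

variable {r : ℕ} {H : Fin r → Type*} [∀ j, NormedAddCommGroup (H j)]
  [∀ j, InnerProductSpace ℂ (H j)]

lemma elem_update_add (u : ∀ j, H j) (i : Fin r) (x y : H i) :
    elem (Function.update u i (x + y)) =
      elem (Function.update u i x) + elem (Function.update u i y) := by
  simp only [elem, ← UniformSpace.Completion.coe_add]
  congr 1; convert algTprod.map_update_add u i x y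

lemma elem_update_smul (u : ∀ j, H j) (i : Fin r) (c : ℂ) (x : H i) :
    elem (Function.update u i (c • x)) = c • elem (Function.update u i x) := by
  simp only [elem, ← UniformSpace.Completion.coe_smul]
  congr 1; convert algTprod.map_update_smul u i c x

lemma inner_elem_update (u w : ∀ j, H j) (i : Fin r) (x : H i) :
    inner ℂ (elem w) (elem (Function.update u i x)) =
      inner ℂ (w i) x * ∏ j ∈ Finset.univ.erase i, inner ℂ (w j) (u j) := by
  rw [inner_elem, ← Finset.mul_prod_erase _ _ (Finset.mem_univ i)]
  congr 1
  · simp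
  · exact Finset.prod_congr rfl fun j hj => by
      rw [Function.update_of_ne (Finset.ne_of_mem_erase hj)]

lemma inner_update_elem (u w : ∀ j, H j) (i : Fin r) (x : H i) :
    inner ℂ (elem (Function.update w i x)) (elem u) =
      inner ℂ x (u i) * ∏ j ∈ Finset.univ.erase i, inner ℂ (w j) (u j) := by
  rw [← inner_conj_symm, inner_elem_update, map_mul, inner_conj_symm, map_prod]
  simp_rw [inner_conj_symm]

lemma norm_elem (u : ∀ j, H j) : ‖elem u‖ = ∏ j, ‖u j‖ := by
  have h := inner_elem u u
  simp_rw [inner_self_eq_ofReal] at h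
  rw [← Complex.ofReal_prod, Complex.ofReal_inj, Finset.prod_pow] at h
  exact (pow_left_inj₀ (norm_nonneg _) (Finset.prod_nonneg fun _ _ => norm_nonneg _)
    two_ne_zero).1 h

lemma continuous_elem_update (u : ∀ j, H j) (i : Fin r) :
    Continuous fun x => elem (Function.update u i x) := by
  let L : H i →ₗ[ℂ] HilbertTensor H :=
    { toFun := fun x => elem (Function.update u i x)
      map_add' := elem_update_add u i
      map_smul' := elem_update_smul u i }
  refine (L.mkContinuous (∏ j ∈ Finset.univ.erase i, ‖u j‖) fun x => ?_).continuous
  change ‖elem (Function.update u i x)‖ ≤ _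
  rw [norm_elem, ← Finset.mul_prod_erase _ _ (Finset.mem_univ i), mul_comm]
  refine le_of_eq ?_
  congr 1
  · exact Finset.prod_congr rfl fun j hj => by
      rw [Function.update_of_ne (Finset.ne_of_mem_erase hj)]
  · simp

lemma eq_zero_of_inner_elem (v : HilbertTensor H) (h : ∀ w, inner ℂ (elem w) v = 0) : v = 0 := by
  refine UniformSpace.Completion.denseRange_coe.eq_zero_of_inner_right (𝕜 := ℂ) fun t => ?_
  induction t using algTensor_induction with
  | h1 c u =>
    rw [UniformSpace.Completion.coe_smul, inner_smul_left]
    exact mul_eq_zero_of_right _ (h u)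
  | h2 s t hs ht => rw [UniformSpace.Completion.coe_add, inner_add_left, hs, ht, add_zero]

/-- For a normal operator `X` the closure in the definition of `lift j X` is the graph of an
operator, so that `lift j X` is that closed operator. -/
theorem lift_graph [∀ j, CompleteSpace (H j)] (j : Fin r) {X : H j →ₗ.[ℂ] H j}
    (hX : IsNormalOp X) : (lift j X).graph = (liftGraph j X).topologicalClosure := by
  refine Submodule.toLinearPMap_graph_eq _ fun p hp hp0 => ?_
  have key : ∀ (w : ∀ i, H i) (y : H j), (w j, y) ∈ (X†).graph →
      inner ℂ (elem (Function.update w j y)) p.1 = inner ℂ (elem w) p.2 := by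
    intro w y hwy
    let C : Submodule ℂ (HilbertTensor H × HilbertTensor H) :=
      LinearMap.ker (((innerSL ℂ (elem (Function.update w j y))).comp
        (ContinuousLinearMap.fst ℂ _ _) - (innerSL ℂ (elem w)).comp
        (ContinuousLinearMap.snd ℂ _ _) :
          HilbertTensor H × HilbertTensor H →L[ℂ] ℂ) : _ →ₗ[ℂ] ℂ)
    have hC : IsClosed (C : Set (HilbertTensor H × HilbertTensor H)) :=
      ContinuousLinearMap.isClosed_ker _
    have hle : (liftGraph j X).topologicalClosure ≤ C :=
      Submodule.topologicalClosure_minimal _ (Submodule.span_le.2 ?_) hC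
    · have := hle hp
      simpa [C, sub_eq_zero] using this
    · rintro _ ⟨u, x, hux, rfl⟩
      simp only [C, SetLike.mem_coe, LinearMap.mem_ker, ContinuousLinearMap.coe_coe,
        sub_apply, ContinuousLinearMap.comp_apply, ContinuousLinearMap.coe_fst',
        ContinuousLinearMap.coe_snd', innerSL_apply_apply]
      rw [inner_elem_update, inner_update_elem, ← sub_mul]
      obtain ⟨a, ha, hax⟩ := LinearPMap.mem_graph_iff _ |>.1 hux
      obtain ⟨b, hb, hby⟩ := LinearPMap.mem_graph_iff _ |>.1 hwy
      have := LinearPMap.adjoint_isFormalAdjoint hX.dense b a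
      rw [ha, hb, hax, hby] at this
      rw [this, sub_self, zero_mul]
  refine eq_zero_of_inner_elem _ fun w => ?_
  have hd : Dense ((X†).domain : Set (H j)) := hX.domain_eq ▸ hX.dense
  have hcont : Continuous fun x => inner ℂ (elem (Function.update w j x)) p.2 :=
    (continuous_elem_update w j).inner continuous_const
  have h0 := hcont.ext_on hd (continuous_const (y := (0 : ℂ))) fun x hx => by
    have := key (Function.update w j x) (X† ⟨x, hx⟩)
      (by simpa using (X†).mem_graph ⟨x, hx⟩)
    rw [hp0, inner_zero_right] at this
    exact this.symm
  simpa using congrFun h0 (w j)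

end LiftWellDefined

section Calculus

variable {Ω K : Type*} [MeasurableSpace Ω] [NormedAddCommGroup K] [InnerProductSpace ℂ K]
  [CompleteSpace K]

variable (Ω K) in
/-- A spectral measure: a projection-valued measure on `Ω` acting on `K`, countably additive in the
strong operator topology. Only the values on measurable sets matter. -/
structure SpectralMeasure where
  proj : Set Ω → K →L[ℂ] K
  isStarProjection : ∀ B, MeasurableSet B → IsStarProjection (proj B)
  proj_univ : proj Set.univ = 1
  hasSum_iUnion : ∀ B : ℕ → Set Ω, (∀ n, MeasurableSet (B n)) →
    Pairwise (Function.onFun Disjoint B) → ∀ u, HasSum (fun n => proj (B n) u) (proj (⋃ n, B n) u)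

namespace SpectralMeasure

variable (E : SpectralMeasure Ω K)

lemma proj_empty : E.proj ∅ = 0 := by
  ext u
  have h := E.hasSum_iUnion (fun _ => ∅) (fun _ => MeasurableSet.empty)
    (fun _ _ _ => disjoint_bot_left) u
  have := h.summable.tendsto_atTop_zero
  simpa using tendsto_nhds_unique tendsto_const_nhds this

lemma norm_sq_proj {B : Set Ω} (hB : MeasurableSet B) (u : K) :
    ‖E.proj B u‖ ^ 2 = (inner ℂ u (E.proj B u)).re := by
  have h := E.isStarProjection B hB
  have h1 : E.proj B (E.proj B u) = E.proj B u := by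
    rw [← mul_apply_eq_comp, h.isIdempotentElem.eq]
  have h2 : inner ℂ (E.proj B u) (E.proj B u) = inner ℂ u (E.proj B (E.proj B u)) := by
    rw [← ContinuousLinearMap.adjoint_inner_right, ← ContinuousLinearMap.star_eq_adjoint,
      h.isSelfAdjoint.star_eq]
  rw [h1] at h2
  rw [← h2, inner_self_eq_ofReal, Complex.ofReal_re]

/-- The finite scalar measure `B ↦ ⟪u, E(B) u⟫ = ‖E(B) u‖²`. -/
def scalarMeasure (u : K) : Measure Ω :=
  Measure.ofMeasurable (fun B _ => ENNReal.ofReal (‖E.proj B u‖ ^ 2)) (by simp [E.proj_empty])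
    (by
      intro B hB hd
      have h := (E.hasSum_iUnion B hB hd u).mapL (innerSL ℂ u)
      have h2 := Complex.hasSum_re h
      simp only [innerSL_apply_apply, ← E.norm_sq_proj (hB _),
        ← E.norm_sq_proj (MeasurableSet.iUnion hB)] at h2
      rw [← h2.tsum_eq, ENNReal.ofReal_tsum_of_nonneg (fun _ => sq_nonneg _) h2.summable])

/-- The integral `∫ s dE` of a simple function. -/
def simpleIntegral (s : SimpleFunc Ω ℂ) (u : K) : K :=
  ∑ c ∈ s.range, c • E.proj (s ⁻¹' {c}) u

/-- `E.HasIntegral g u v`: the vector `u` lies in the domain `{u | g ∈ L²(⟪u, E(·) u⟫)}` of the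
spectral integral `∫ g dE`, and `(∫ g dE) u = v`, the limit of `(∫ s dE) u` for simple functions
`s → g` in `L²(⟪u, E(·) u⟫)`. -/
def HasIntegral (g : Ω → ℂ) (u v : K) : Prop :=
  MemLp g 2 (E.scalarMeasure u) ∧
    ∃ s : ℕ → SimpleFunc Ω ℂ,
      Tendsto (fun n => eLpNorm (fun z => g z - s n z) 2 (E.scalarMeasure u)) atTop (𝓝 0) ∧
      Tendsto (fun n => E.simpleIntegral (s n) u) atTop (𝓝 v)

end SpectralMeasure

variable {r : ℕ}

/-- The joint projector-nilpotent decomposition of a tuple of operators: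
`T j = ∫ z j dE(z) + N j`, with a joint spectral measure `E` on `ℂ^r` and bounded nilpotent
operators `N j` which commute with each other and with `E`. Here `N j` collects the local nilpotent
components, `(N j)^q dE(z) = (T j - z j)^q dE(z)`. -/
structure IsProjectorNilpotent (T : Fin r → K →ₗ.[ℂ] K) (E : SpectralMeasure (Fin r → ℂ) K)
    (N : Fin r → K →L[ℂ] K) : Prop where
  decomp : ∀ j u v, (u, v) ∈ (T j).graph ↔ E.HasIntegral (fun z => z j) u (v - N j u)
  nilpotent : ∀ j, IsNilpotent (N j)
  commute : ∀ i j, Commute (N i) (N j)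
  commute_proj : ∀ j B, MeasurableSet B → Commute (N j) (E.proj B)

/-- The partial derivative `∂g / ∂z j`. -/
def partialDeriv (j : Fin r) (g : (Fin r → ℂ) → ℂ) (z : Fin r → ℂ) : ℂ :=
  deriv (fun t => g (Function.update z j t)) (z j)

/-- The iterated partial derivative `∏ j, (∂ / ∂z j) ^ (q j)` of `g`. -/
def mixedDeriv (q : Fin r → ℕ) (g : (Fin r → ℂ) → ℂ) : (Fin r → ℂ) → ℂ :=
  (List.finRange r).foldr (fun j h => (partialDeriv j)^[q j] h) g

/-- The orders `q` occurring for the subset `A`: `1 ≤ q j ≤ ν j - 1` for `j ∈ A`, with `ν j` the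
nilpotency index of `N j`, and `q j = 0` for `j ∉ A`. -/
def admissible (N : Fin r → K →L[ℂ] K) (A : Finset (Fin r)) : Finset (Fin r → ℕ) :=
  Fintype.piFinset fun j => if j ∈ A then Finset.Ico 1 (nilpotencyClass (N j)) else {0}

/-- The operator `∏ j, (N j) ^ (q j)`. -/
def nilpotentPower (N : Fin r → K →L[ℂ] K) (q : Fin r → ℕ) : K →L[ℂ] K :=
  ((List.finRange r).map fun j => N j ^ q j).prod

/-- `F = f(T 0, …, T (r - 1))` in the projector-nilpotent functional calculus of a commuting tuple,
given by the unified compact formula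
`F = ∑_A ∑_q (∫ (∂_A^q f) / (∏ j, (q j)!) dE) ∏_{j ∈ A} (N j)^(q j)`, with `A` running through the
subsets of the index set and `q` through the admissible orders. The domain of `F` is the natural
one. -/
def IsCalculus (f : (Fin r → ℂ) → ℂ) (T : Fin r → K →ₗ.[ℂ] K) (F : K →ₗ.[ℂ] K) : Prop :=
  ∃ (E : SpectralMeasure (Fin r → ℂ) K) (N : Fin r → K →L[ℂ] K), IsProjectorNilpotent T E N ∧
    ∀ u w, (u, w) ∈ F.graph ↔ ∃ v : (Fin r → ℕ) → K,
      (∀ A, ∀ q ∈ admissible N A, E.HasIntegral (fun z => mixedDeriv q f z / ∏ j, (q j).factorial)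
        (nilpotentPower N q u) (v q)) ∧
      w = ∑ A : Finset (Fin r), ∑ q ∈ admissible N A, v q

end Calculus

section TensorCalculus

variable {r : ℕ} {H : Fin r → Type*} [∀ j, NormedAddCommGroup (H j)]
  [∀ j, InnerProductSpace ℂ (H j)]

/-- The tuple of lifted operators. -/
def lifted (X : ∀ j, H j →ₗ.[ℂ] H j) (j : Fin r) : HilbertTensor H →ₗ.[ℂ] HilbertTensor H :=
  lift j (X j)

open scoped Classical in
/-- The tensor-lifted functional calculus `f_⊗(X 0, …, X (r - 1)) := f(X̃ 0, …, X̃ (r - 1))`. -/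
def tensorCalculus (f : (Fin r → ℂ) → ℂ) (X : ∀ j, H j →ₗ.[ℂ] H j) :
    HilbertTensor H →ₗ.[ℂ] HilbertTensor H :=
  if h : ∃ F, IsCalculus f (lifted X) F then h.choose else ⊥

end TensorCalculus

end TensorCalculus

end

namespace TensorCalculus

open scoped ComplexConjugate LinearPMap

/-! ### Unbounded normal operators: adjoints, eigenprojections, resolvents. -/

section NormalOperator

variable {H : Type*} [NormedAddCommGroup H] [InnerProductSpace ℂ H]

/-! Everything reduces to diagonal operators. Call pairwise orthogonal projections `P i` with `∑ P i
= 1` a resolution (`IsResolution`), and suppose `T j = ∑ p i j • P i` on the natural domain.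

Existence: the measure `B ↦ ∑ P i` over `p i ∈ B`, with `N = 0`, is a decomposition. Rigidity: let
`(E, N)` be any decomposition and `u` an eigenvector of `T j` for `c`. Then `∫ (z j - c) dE` sends
`u` to `-N j u`. On the part `v` of `u` where `|z j - c| ≥ ε` this forces `ε ^ k * ‖v‖ ≤ ‖N j ^ k
v‖`, so nilpotency gives `v = 0`. Hence `N j u = 0` and `u` is concentrated on `z j = c`
(`IsProjectorNilpotent.apply_eigenvector`). The ranges of the `P i` consist of joint eigenvectors
and are total, so `N j = 0` and `E` has the atoms `P i` at `p i`. Only `A = ∅` survives in the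
compact formula, no derivative of `f` enters, and `∫ f dE` is the unconditional sum `∑ f (p i) • P
i` (`IsResolution.hasIntegral_iff`). Measurability of `f` is irrelevant because each vector sees
only countably many atoms.

The lifted operators have this form: the tensor products of eigenprojections are a resolution
(`isResolution_jointProj`) that diagonalises them (`lifted_graph_iff`). The first fact needs total
eigenvectors for each `X j`. When only countability of the spectrum is given, a resolvent is a
bounded normal operator with countable spectrum. By Baire, the support of a vector in that spectrum
has an isolated point, and this yields an eigenvector not orthogonal to the given vector
(`eq_zero_of_orthogonal_eigenvectors`). -/

lemma mem_opEigenspace {X : H →ₗ.[ℂ] H} {z : ℂ} {u : H} :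
    u ∈ opEigenspace X z ↔ (u, z • u) ∈ X.graph := Iff.rfl

variable [CompleteSpace H]

lemma mem_adjoint_graph {X : H →ₗ.[ℂ] H} (hd : Dense (X.domain : Set H)) {b y : H} :
    (b, y) ∈ X†.graph ↔ ∀ a x, (a, x) ∈ X.graph → inner ℂ y a = inner ℂ b x := by
  constructor
  · intro h a x hax
    obtain ⟨a', ha, hx⟩ := (LinearPMap.mem_graph_iff _).1 hax
    obtain ⟨b', hb, hy⟩ := (LinearPMap.mem_graph_iff _).1 h
    have := LinearPMap.adjoint_isFormalAdjoint hd b' a'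
    rwa [ha, hb, hx, hy] at this
  · intro h
    have h' : ∀ x : X.domain, inner ℂ y (x : H) = inner ℂ b (X x) := fun x =>
      h _ _ (X.mem_graph x)
    have hb : b ∈ X†.domain := LinearPMap.mem_adjoint_domain_of_exists b ⟨y, h'⟩
    have := LinearPMap.adjoint_apply_eq hd ⟨b, hb⟩ h'
    exact (LinearPMap.mem_graph_iff _).2 ⟨⟨b, hb⟩, rfl, this⟩

namespace IsNormalOp

variable {X : H →ₗ.[ℂ] H} (hX : IsNormalOp X)

include hX

lemma exists_adjoint {a x : H} (h : (a, x) ∈ X.graph) : ∃ x', (a, x') ∈ X†.graph := by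
  obtain ⟨a', rfl, -⟩ := (LinearPMap.mem_graph_iff _).1 h
  have ha : (a' : H) ∈ X†.domain := by rw [← hX.domain_eq]; exact a'.2
  exact ⟨X† ⟨a', ha⟩, LinearPMap.mem_graph _ ⟨_, ha⟩⟩

lemma exists_of_adjoint {a x : H} (h : (a, x) ∈ X†.graph) : ∃ x', (a, x') ∈ X.graph := by
  obtain ⟨a', rfl, -⟩ := (LinearPMap.mem_graph_iff _).1 h
  have ha : (a' : H) ∈ X.domain := by rw [hX.domain_eq]; exact a'.2
  exact ⟨X ⟨a', ha⟩, LinearPMap.mem_graph _ ⟨_, ha⟩⟩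

lemma norm_eq_of_graph {a x x' : H} (h : (a, x) ∈ X.graph) (h' : (a, x') ∈ X†.graph) :
    ‖x‖ = ‖x'‖ := by
  obtain ⟨b, hb, rfl⟩ := (LinearPMap.mem_graph_iff _).1 h
  obtain ⟨b', hb', rfl⟩ := (LinearPMap.mem_graph_iff _).1 h'
  exact hX.norm_eq b b' (hb.trans hb'.symm)

/-- Polarization of the norm equality that defines normality. -/
lemma inner_eq_of_graph {a x x' b y y' : H} (h : (a, x) ∈ X.graph) (h' : (a, x') ∈ X†.graph)
    (k : (b, y) ∈ X.graph) (k' : (b, y') ∈ X†.graph) : inner ℂ x y = inner ℂ x' y' := by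
  have key : ∀ c : ℂ, ‖x + c • y‖ = ‖x' + c • y'‖ := fun c =>
    hX.norm_eq_of_graph (a := a + c • b) (X.graph.add_mem h (X.graph.smul_mem c k))
      (X†.graph.add_mem h' (X†.graph.smul_mem c k'))
  have h1 := key 1
  have h2 := key (-1)
  have h3 := key Complex.I
  have h4 := key (-Complex.I)
  simp only [one_smul, neg_smul, ← sub_eq_add_neg] at h1 h2 h3 h4
  rw [inner_eq_sum_norm_sq_div_four, inner_eq_sum_norm_sq_div_four (𝕜 := ℂ) x' y']
  simp only [RCLike.I_to_complex]
  rw [h1, h2, h3, h4]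

/-- Normality passes from `X` to `X - z`: the cross terms agree because `X†` is the formal adjoint.
-/
lemma inner_sub_eq_of_graph {a x x' b y y' : H} (h : (a, x) ∈ X.graph)
    (h' : (a, x') ∈ X†.graph) (k : (b, y) ∈ X.graph) (k' : (b, y') ∈ X†.graph) (z : ℂ) :
    inner ℂ (x - z • a) (y - z • b) = inner ℂ (x' - conj z • a) (y' - conj z • b) := by
  have e1 := hX.inner_eq_of_graph h h' k k'
  have e2 := (mem_adjoint_graph hX.dense).1 h' _ _ k
  have e3 := (mem_adjoint_graph hX.dense).1 k' _ _ h
  have e4 : inner ℂ a y' = inner ℂ x b := by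
    rw [← inner_conj_symm, e3, inner_conj_symm]
  simp only [inner_sub_left, inner_sub_right, inner_smul_left, inner_smul_right,
    Complex.conj_conj, e1, e2, e4]
  ring

/-- Normality of `X - z` gives `‖(X† - conj z) e‖ = ‖(X - z) e‖ = 0`. -/
lemma adjoint_eigenvector {z : ℂ} {e : H} (he : e ∈ opEigenspace X z) :
    (e, conj z • e) ∈ X†.graph := by
  rw [mem_opEigenspace] at he
  obtain ⟨e', he'⟩ := hX.exists_adjoint he
  have := hX.inner_sub_eq_of_graph he he' he he' z
  rw [sub_self, inner_zero_left, eq_comm, inner_self_eq_zero, sub_eq_zero] at this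
  rwa [← this]

lemma isClosed_opEigenspace (z : ℂ) : IsClosed (opEigenspace X z : Set H) := by
  have h : IsClosed (X.graph : Set (H × H)) := hX.closed
  exact h.preimage (f := fun u : H => (u, z • u)) (by fun_prop)

lemma mem_topologicalClosure_opEigenspace {z : ℂ} {u : H} :
    u ∈ (opEigenspace X z).topologicalClosure ↔ u ∈ opEigenspace X z := by
  rw [(hX.isClosed_opEigenspace z).submodule_topologicalClosure_eq]

lemma eigenProj_mem (z : ℂ) (u : H) : eigenProj X z u ∈ opEigenspace X z :=
  hX.mem_topologicalClosure_opEigenspace.1 (Submodule.starProjection_apply_mem _ u)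

lemma eigenProj_eq_self {z : ℂ} {u : H} (hu : u ∈ opEigenspace X z) : eigenProj X z u = u :=
  Submodule.starProjection_eq_self_iff.2 (hX.mem_topologicalClosure_opEigenspace.2 hu)

/-- Testing against an eigenvector `w` moves `X` onto `w`, where `X†` acts as `conj z`. This is how
eigenprojections commute with `X`, and it makes distinct eigenspaces orthogonal. -/
lemma eigenProj_graph (z : ℂ) {u y : H} (h : (u, y) ∈ X.graph) :
    eigenProj X z y = z • eigenProj X z u := by
  refine Submodule.eq_starProjection_of_mem_of_inner_eq_zero
    (Submodule.smul_mem _ _ (Submodule.starProjection_apply_mem _ u)) fun w hw => ?_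
  have h1 := (mem_adjoint_graph hX.dense).1
    (hX.adjoint_eigenvector (hX.mem_topologicalClosure_opEigenspace.1 hw)) _ _ h
  have h2 := (opEigenspace X z).topologicalClosure.starProjection_inner_eq_zero u w hw
  rw [inner_smul_left, Complex.conj_conj] at h1
  have h3 : inner ℂ y w = conj z * inner ℂ u w := by
    rw [← inner_conj_symm, ← h1, map_mul, inner_conj_symm]
  rw [inner_sub_left, sub_eq_zero] at h2
  rw [inner_sub_left, inner_smul_left, h3, h2, eigenProj, sub_self]

lemma eigenProj_eq_zero {z z' : ℂ} (hz : z ≠ z') {u : H} (hu : u ∈ opEigenspace X z') :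
    eigenProj X z u = 0 := by
  have h := hX.eigenProj_graph z (mem_opEigenspace.1 hu)
  rw [map_smul, eq_comm, ← sub_eq_zero, ← sub_smul, smul_eq_zero, sub_eq_zero] at h
  exact h.resolve_left hz

omit hX [CompleteSpace H] in
lemma eq_zero_of_notMem_opSpectrum {z : ℂ} (hz : z ∉ opSpectrum X) {u : H}
    (hu : u ∈ opEigenspace X z) : u = 0 := by
  simp only [opSpectrum, Set.mem_ofPred_eq, not_not] at hz
  obtain ⟨R, -, hR⟩ := hz
  obtain ⟨a, rfl, ha⟩ := (LinearPMap.mem_graph_iff _).1 (mem_opEigenspace.1 hu)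
  dsimp only at ha
  rw [← hR a, ha, sub_self, map_zero]

end IsNormalOp

/-- `R` is the resolvent `(X - z)⁻¹`. -/
structure IsResolvent (X : H →ₗ.[ℂ] H) (z : ℂ) (R : H →L[ℂ] H) : Prop where
  graph : ∀ v, (R v, v + z • R v) ∈ X.graph
  apply_sub : ∀ {u y}, (u, y) ∈ X.graph → R (y - z • u) = u

omit [CompleteSpace H] in
lemma exists_isResolvent {X : H →ₗ.[ℂ] H} {z : ℂ} (hz : z ∉ opSpectrum X) :
    ∃ R, IsResolvent X z R := by
  simp only [opSpectrum, Set.mem_ofPred_eq, not_not] at hz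
  obtain ⟨R, h1, h2⟩ := hz
  refine ⟨R, h1, fun {u y} h => ?_⟩
  obtain ⟨a, rfl, rfl⟩ := (LinearPMap.mem_graph_iff _).1 h
  exact h2 a

namespace IsResolvent

variable {X : H →ₗ.[ℂ] H} {z w : ℂ} {R S : H →L[ℂ] H}

omit [CompleteSpace H] in
-- The resolvent identity, from applying `R` to `(X - z) S v = v + (w - z) S v`.
lemma sub_apply (hR : IsResolvent X z R) (hS : IsResolvent X w S) (v : H) :
    S v - R v = (w - z) • R (S v) := by
  have h := hR.apply_sub (hS.graph v)
  rw [add_sub_assoc, ← sub_smul, map_add, map_smul] at h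
  exact sub_eq_of_eq_add' h.symm

lemma isStarNormal (hX : IsNormalOp X) (hR : IsResolvent X z R) : IsStarNormal R := by
  -- `adj` and `adj'` together say that `R†` is the resolvent of `X†` at `conj z`.
  have adj : ∀ {b y : H}, (b, y) ∈ X†.graph → R.adjoint (y - conj z • b) = b := by
    intro b y h
    refine ext_inner_right ℂ fun v => ?_
    have := (mem_adjoint_graph hX.dense).1 h _ _ (hR.graph v)
    rw [ContinuousLinearMap.adjoint_inner_left, inner_sub_left, this, inner_smul_left,
      Complex.conj_conj, inner_add_right, inner_smul_right, add_sub_cancel_right]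
  have adj' : ∀ b, (R.adjoint b, b + conj z • R.adjoint b) ∈ X†.graph := by
    refine fun b => (mem_adjoint_graph hX.dense).2 fun a x h => ?_
    have := hR.apply_sub h
    rw [inner_add_left, inner_smul_left, Complex.conj_conj,
      ContinuousLinearMap.adjoint_inner_left, ContinuousLinearMap.adjoint_inner_left]
    nth_rewrite 1 [← this]
    rw [map_sub, map_smul, inner_sub_right, inner_smul_right]
    ring
  refine ⟨ContinuousLinearMap.ext fun a => ?_⟩
  change R.adjoint (R a) = R (R.adjoint a)
  obtain ⟨u', hu'⟩ := hX.exists_adjoint (hR.graph (R.adjoint a))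
  -- It now suffices that `R a = (X† - conj z) R R† a`. Pairing with `b`, and writing `b = (X† -
  -- conj z) R† b`, this becomes the normality identity for `X - z`.
  rw [← adj hu']
  congr 1
  refine ext_inner_right ℂ fun b => ?_
  obtain ⟨v, hv⟩ := hX.exists_of_adjoint (adj' b)
  have h := hX.inner_sub_eq_of_graph (hR.graph (R.adjoint a)) hu' hv (adj' b) z
  rw [add_sub_cancel_right, add_sub_cancel_right] at h
  rw [← h, ContinuousLinearMap.adjoint_inner_left, hR.apply_sub hv,
    ContinuousLinearMap.adjoint_inner_right]

omit [CompleteSpace H] in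
-- Spectral mapping for the resolvent: formally `(μ - R)⁻¹ = μ⁻¹ (1 + μ⁻¹ S)` with `S = (X - z -
-- μ⁻¹)⁻¹`.
lemma notMem_spectrum (hR : IsResolvent X z R) {μ : ℂ} (hμ : μ ≠ 0)
    (hS : IsResolvent X (z + μ⁻¹) S) : μ ∉ spectrum ℂ R := by
  rw [spectrum.notMem_iff]
  have h1 : ∀ v, R (S v) = μ • (S v - R v) := fun v => by
    rw [hR.sub_apply hS, add_sub_cancel_left, smul_inv_smul₀ hμ]
  have h2 : ∀ v, S (R v) = μ • (S v - R v) := fun v => by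
    have := hS.sub_apply hR v
    rw [sub_add_cancel_left, neg_smul, ← neg_sub, neg_inj] at this
    rw [this, smul_inv_smul₀ hμ]
  refine ⟨⟨algebraMap ℂ _ μ - R, μ⁻¹ • (1 + μ⁻¹ • S), ?_, ?_⟩, rfl⟩ <;> ext v
  · simp [Algebra.algebraMap_eq_smul_one, h1, smul_smul, hμ, smul_sub, smul_add]
  · simp [Algebra.algebraMap_eq_smul_one, h2, smul_smul, hμ, smul_sub, smul_add]

end IsResolvent

end NormalOperator

end TensorCalculus

/-! ### Totality of eigenvectors for countable spectrum. -/

namespace TensorCalculus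

open scoped ComplexConjugate LinearPMap

/-- A nonempty countable closed set in a complete metric space has an isolated point. -/
lemma exists_isolated_of_countable {Y : Type*} [MetricSpace Y] [CompleteSpace Y] {C : Set Y}
    (hC : IsClosed C) (hne : C.Nonempty) (hc : C.Countable) :
    ∃ x ∈ C, IsClosed (C \ {x}) := by
  have : CompleteSpace C := hC.completeSpace_coe
  have : Nonempty C := hne.to_subtype
  have : Countable C := hc.to_subtype
  -- Baire: `C` is a countable union of closed singletons, so one of them has interior.
  obtain ⟨x, hx⟩ := nonempty_interior_of_iUnion_of_closed (X := C) (f := fun x : C => {x})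
    (fun _ => isClosed_singleton) (by ext; simp)
  refine ⟨x, x.2, ?_⟩
  have h : IsOpen ({x} : Set C) := by
    rw [← interior_eq_iff_isOpen]
    exact (Set.subset_singleton_iff_eq.1 interior_subset).resolve_left hx.ne_empty
  have h2 := hC.isClosedEmbedding_subtypeVal.isClosedMap _ h.isClosed_compl
  convert h2 using 1
  ext y
  simp only [Set.mem_sdiff, Set.mem_singleton_iff, Set.mem_image, Set.mem_compl_iff]
  constructor
  · rintro ⟨hy, hyx⟩
    exact ⟨⟨y, hy⟩, fun h => hyx (congrArg Subtype.val h), rfl⟩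
  · rintro ⟨y, hyx, rfl⟩
    exact ⟨y.2, fun h => hyx (Subtype.ext h)⟩

section

variable {H : Type*} [NormedAddCommGroup H] [InnerProductSpace ℂ H] [CompleteSpace H]

/-- A vector orthogonal to all eigenvectors of a bounded normal operator with countable spectrum
vanishes. -/
theorem eq_zero_of_orthogonal_eigenvectors {R : H →L[ℂ] H} (hR : IsStarNormal R)
    (hc : (spectrum ℂ R).Countable) {u : H}
    (hu : ∀ (μ : ℂ) (e : H), R e = μ • e → inner ℂ e u = 0) : u = 0 := by
  set φ := cfcHom (R := ℂ) hR with hφ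
  have hφc : Continuous φ := (cfcHom_isClosedEmbedding hR).continuous
  let I : Ideal C(spectrum ℂ R, ℂ) :=
    { carrier := {g | φ g u = 0}
      add_mem' := fun {a b} ha hb => by
        simp only [Set.mem_ofPred_eq] at ha hb ⊢
        rw [map_add, add_apply, ha, hb, add_zero]
      zero_mem' := by simp
      smul_mem' := fun a b hb => by
        simp only [Set.mem_ofPred_eq] at hb ⊢
        rw [smul_eq_mul, map_mul, mul_apply_eq_comp, hb, map_zero] }
  have hmem : ∀ g, g ∈ I ↔ φ g u = 0 := fun _ => Iff.rfl
  have hI : IsClosed (I : Set C(spectrum ℂ R, ℂ)) := by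
    have : Continuous fun g => φ g u := by fun_prop
    exact isClosed_singleton.preimage this
  -- A closed ideal of continuous functions is determined by its zero set `C`. Here `C` plays the
  -- role of the spectral support of `u`.
  have hI2 := ContinuousMap.idealOfSet_ofIdeal_isClosed hI
  have hmem2 : ∀ g, φ g u = 0 ↔ ∀ x ∈ (ContinuousMap.setOfIdeal I)ᶜ, g x = 0 := fun g => by
    rw [← hmem, ← ContinuousMap.mem_idealOfSet, hI2]
  set C := (ContinuousMap.setOfIdeal I)ᶜ with hCdef
  have hC : IsClosed C := (ContinuousMap.setOfIdeal_open I).isClosed_compl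
  rcases C.eq_empty_or_nonempty with h0 | hne
  · have := (hmem2 1).2 (by simp [h0])
    simpa using this
  exfalso
  have : Countable (spectrum ℂ R) := hc.to_subtype
  obtain ⟨x, hx, hxC⟩ := exists_isolated_of_countable hC hne C.to_countable
  -- Urysohn bump at the isolated point, zero on the rest of `C`.
  obtain ⟨h, h0, h1, -⟩ := exists_continuous_zero_one_of_isClosed hxC
    (isClosed_singleton (x := x)) (by simp)
  let g : C(spectrum ℂ R, ℂ) := ⟨fun y => (h y : ℂ), by fun_prop⟩
  have hg0 : ∀ y ∈ C, y ≠ x → g y = 0 := fun y hy hyx => by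
    change ((h y : ℝ) : ℂ) = 0
    rw [h0 ⟨hy, hyx⟩]; simp
  have hg1 : g x = 1 := by
    change ((h x : ℝ) : ℂ) = 1
    rw [h1 rfl]; simp
  -- `star g * g` instead of `g`, so that `⟪v, u⟫ = ‖φ g u‖ ^ 2`. Since `(id - x) * (star g * g)`
  -- vanishes on `C`, `v` satisfies the eigenvector equation for `x`.
  set v := φ (star g * g) u with hv
  have hev : R v = (x : ℂ) • v := by
    have key := (hmem2 ((ContinuousMap.restrict (spectrum ℂ R) (ContinuousMap.id ℂ) -
      (x : ℂ) • 1) * (star g * g))).2 fun y hy => by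
        by_cases hyx : y = x
        · simp [hyx]
        · simp [hg0 y hy hyx]
    rw [map_mul, map_sub, hφ, cfcHom_id hR, ← hφ, map_smul, map_one, mul_apply_eq_comp, ← hv,
      sub_apply, sub_eq_zero] at key
    simpa using key
  have h2 := hu _ _ hev
  rw [hv, map_mul, map_star, mul_apply_eq_comp, ContinuousLinearMap.star_eq_adjoint,
    ContinuousLinearMap.adjoint_inner_left, inner_self_eq_zero, hmem2] at h2
  exact one_ne_zero (hg1.symm.trans (h2 x hx))

/-- The eigenvectors of a normal operator with pure point spectrum are total. -/
theorem IsNormalOp.topologicalClosure_iSup_opEigenspace {X : H →ₗ.[ℂ] H} (hX : IsNormalOp X)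
    (hpp : HasPurePointSpectrum X) : (⨆ z, opEigenspace X z).topologicalClosure = ⊤ := by
  refine hpp.elim (fun hc => ?_) id
  obtain ⟨z₀, hz₀⟩ : ∃ z₀, z₀ ∉ opSpectrum X := by
    by_contra! h
    exact not_countable_complex (hc.mono fun z _ => h z)
  obtain ⟨R, hR⟩ := exists_isResolvent hz₀
  rw [Submodule.topologicalClosure_eq_top_iff, Submodule.eq_bot_iff]
  intro u hu
  have hspec : (spectrum ℂ R).Countable := by
    refine ((hc.image fun z => (z - z₀)⁻¹).union (Set.countable_singleton 0)).mono fun μ hμ => ?_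
    by_cases h0 : μ = 0
    · exact Or.inr h0
    · refine Or.inl ⟨z₀ + μ⁻¹, ?_, by simp⟩
      by_contra hS
      obtain ⟨S, hS⟩ := exists_isResolvent hS
      exact hR.notMem_spectrum h0 hS hμ
  refine eq_zero_of_orthogonal_eigenvectors (hR.isStarNormal hX) hspec fun μ e he => ?_
  have hg := hR.graph e
  rw [he] at hg
  -- `R` is injective, so `μ = 0` gives only `e = 0`; for `μ ≠ 0`, `R e = μ • e` means `X e = (z₀ +
  -- μ⁻¹) • e`.
  by_cases h0 : μ = 0
  · have : e = 0 := by
      subst h0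
      rw [zero_smul, smul_zero, add_zero] at hg
      exact X.graph_fst_eq_zero_snd hg rfl
    rw [this, inner_zero_left]
  · refine hu _ (Submodule.mem_iSup_of_mem (z₀ + μ⁻¹) (mem_opEigenspace.2 ?_))
    convert X.graph.smul_mem μ⁻¹ hg using 1
    simp [add_smul, smul_smul, h0, mul_comm, add_comm]

end

end TensorCalculus

/-! ### Spectral measures and spectral integrals. -/

namespace TensorCalculus

open MeasureTheory Filter Topology
open scoped ENNReal

namespace SpectralMeasure

variable {Ω K : Type*} [MeasurableSpace Ω] [NormedAddCommGroup K] [InnerProductSpace ℂ K]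
  [CompleteSpace K] (E : SpectralMeasure Ω K)

lemma proj_union {B C : Set Ω} (hB : MeasurableSet B) (hC : MeasurableSet C)
    (hd : Disjoint B C) : E.proj (B ∪ C) = E.proj B + E.proj C := by
  ext u
  let D : ℕ → Set Ω := fun n => if n = 0 then B else if n = 1 then C else ∅
  have hD : ∀ n, n ∉ ({0, 1} : Finset ℕ) → D n = ∅ := fun n hn => by
    simp only [Finset.mem_insert, Finset.mem_singleton, not_or] at hn
    simp [D, hn.1, hn.2]
  have hm : ∀ n, MeasurableSet (D n) := fun n => by
    simp only [D]; split_ifs <;> simp [hB, hC]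
  have hp : Pairwise (Function.onFun Disjoint D) := by
    intro m n hmn
    simp only [Function.onFun, D]
    split_ifs <;> simp_all [hd.symm]
  have hU : ⋃ n, D n = B ∪ C := by
    ext x
    simp only [Set.mem_iUnion, Set.mem_union]
    constructor
    · rintro ⟨n, hn⟩
      simp only [D] at hn
      split_ifs at hn
      · exact Or.inl hn
      · exact Or.inr hn
      · exact hn.elim
    · rintro (h | h)
      · exact ⟨0, h⟩
      · exact ⟨1, h⟩
  have h := E.hasSum_iUnion D hm hp u
  have h2 := hasSum_sum_of_ne_finset_zero (L := .unconditional ℕ)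
    (f := fun n => E.proj (D n) u) (s := {0, 1}) fun n hn => by rw [hD n hn, E.proj_empty]; rfl
  rw [hU] at h
  simpa [D] using h.unique h2

/-- Idempotency of `P + Q` gives `P Q + Q P = 0`. Multiplying by `P` on either side gives `P Q = -P
Q P = Q P`, so `2 P Q = 0`. -/
lemma proj_mul_of_disjoint {B C : Set Ω} (hB : MeasurableSet B) (hC : MeasurableSet C)
    (hd : Disjoint B C) : E.proj B * E.proj C = 0 := by
  have h := (E.isStarProjection _ (hB.union hC)).isIdempotentElem.eq
  have hb := (E.isStarProjection _ hB).isIdempotentElem.eq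
  have hc := (E.isStarProjection _ hC).isIdempotentElem.eq
  rw [E.proj_union hB hC hd] at h
  set P := E.proj B
  set Q := E.proj C
  have h1 : P * Q + Q * P = 0 := by
    have : (P + Q) * (P + Q) = P * P + (P * Q + Q * P) + Q * Q := by noncomm_ring
    rw [this, hb, hc, add_right_comm] at h
    simpa using h
  have h2 : P * Q + P * Q * P = 0 := by
    have := congrArg (P * ·) h1
    simpa only [mul_add, ← mul_assoc, hb, mul_zero] using this
  have h3 : P * Q * P + Q * P = 0 := by
    have := congrArg (· * P) h1
    simpa only [add_mul, mul_assoc, hb, zero_mul] using this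
  have h4 : (2 : ℂ) • (P * Q) = 0 := by
    rw [two_smul]
    calc P * Q + P * Q = (P * Q + Q * P) + (P * Q + P * Q * P) - (P * Q * P + Q * P) := by abel
      _ = 0 := by rw [h1, h2, h3]; simp
  simpa using h4

lemma proj_mul {B C : Set Ω} (hB : MeasurableSet B) (hC : MeasurableSet C) :
    E.proj B * E.proj C = E.proj (B ∩ C) := by
  have e1 : E.proj B = E.proj (B ∩ C) + E.proj (B \ C) := by
    rw [← E.proj_union (hB.inter hC) (hB.diff hC) disjoint_inf_sdiff, Set.inter_union_sdiff]
  have e2 : E.proj C = E.proj (B ∩ C) + E.proj (C \ B) := by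
    rw [← E.proj_union (hB.inter hC) (hC.diff hB) (by
      rw [Set.inter_comm]; exact disjoint_inf_sdiff), Set.inter_comm, Set.inter_union_sdiff]
  rw [e1, e2, add_mul, mul_add, mul_add,
    (E.isStarProjection _ (hB.inter hC)).isIdempotentElem.eq,
    E.proj_mul_of_disjoint (hB.inter hC) (hC.diff hB)
      (Set.disjoint_sdiff_right.mono_left Set.inter_subset_left),
    E.proj_mul_of_disjoint (hB.diff hC) (hB.inter hC)
      (Set.disjoint_sdiff_left.mono_right Set.inter_subset_right),
    E.proj_mul_of_disjoint (hB.diff hC) (hC.diff hB)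
      (Set.disjoint_sdiff_left.mono_right Set.sdiff_subset)]
  simp

lemma proj_commute {B C : Set Ω} (hB : MeasurableSet B) (hC : MeasurableSet C) :
    Commute (E.proj B) (E.proj C) := by
  rw [Commute, SemiconjBy, E.proj_mul hB hC, E.proj_mul hC hB, Set.inter_comm]

lemma inner_proj_of_disjoint {B C : Set Ω} (hB : MeasurableSet B) (hC : MeasurableSet C)
    (hd : Disjoint B C) (u v : K) : inner ℂ (E.proj B u) (E.proj C v) = 0 := by
  rw [← ContinuousLinearMap.adjoint_inner_right, ← ContinuousLinearMap.star_eq_adjoint,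
    (E.isStarProjection _ hB).isSelfAdjoint.star_eq, ← mul_apply_eq_comp,
    E.proj_mul_of_disjoint hB hC hd]
  simp

lemma scalarMeasure_apply (u : K) {B : Set Ω} (hB : MeasurableSet B) :
    E.scalarMeasure u B = ENNReal.ofReal (‖E.proj B u‖ ^ 2) :=
  Measure.ofMeasurable_apply B hB

lemma scalarMeasure_eq_zero_iff (u : K) {B : Set Ω} (hB : MeasurableSet B) :
    E.scalarMeasure u B = 0 ↔ E.proj B u = 0 := by
  rw [E.scalarMeasure_apply u hB, ENNReal.ofReal_eq_zero, ← norm_eq_zero (a := E.proj B u)]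
  constructor
  · intro h
    exact pow_eq_zero_iff two_ne_zero |>.1 (le_antisymm h (sq_nonneg _))
  · intro h; simp [h]

instance (u : K) : IsFiniteMeasure (E.scalarMeasure u) :=
  ⟨by rw [E.scalarMeasure_apply u .univ]; exact ENNReal.ofReal_lt_top⟩

/-- The vector measure `B ↦ E(B) u` as a set function with values in `ℂ →L[ℝ] K`. -/
noncomputable def vectorSet (u : K) (B : Set Ω) : ℂ →L[ℝ] K :=
  (ContinuousLinearMap.toSpanSingleton ℂ (E.proj B u)).restrictScalars ℝ

lemma vectorSet_apply (u : K) (B : Set Ω) (c : ℂ) : E.vectorSet u B c = c • E.proj B u := rfl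

lemma finMeasAdditive_vectorSet (u : K) :
    FinMeasAdditive (E.scalarMeasure u) (E.vectorSet u) := by
  intro B C hB hC _ _ hd
  ext
  simp [vectorSet_apply, E.proj_union hB hC hd]

/-- Brings in the linearity of `setToSimpleFunc`, which is why `vectorSet` takes real-linear maps as
values. -/
lemma simpleIntegral_eq (s : SimpleFunc Ω ℂ) (u : K) :
    E.simpleIntegral s u = s.setToSimpleFunc (E.vectorSet u) := rfl

lemma simpleIntegral_sub (s t : SimpleFunc Ω ℂ) (u : K) :
    E.simpleIntegral (s - t) u = E.simpleIntegral s u - E.simpleIntegral t u :=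
  SimpleFunc.setToSimpleFunc_sub _ (E.finMeasAdditive_vectorSet u)
    (SimpleFunc.integrable_of_isFiniteMeasure _) (SimpleFunc.integrable_of_isFiniteMeasure _)

lemma simpleIntegral_const (c : ℂ) (u : K) :
    E.simpleIntegral (SimpleFunc.const Ω c) u = c • u := by
  rw [simpleIntegral_eq, SimpleFunc.setToSimpleFunc_const, vectorSet_apply, E.proj_univ]
  · simp
  · ext; simp [vectorSet_apply, E.proj_empty]

lemma simpleIntegral_map (A : K →L[ℂ] K) (hA : ∀ B, MeasurableSet B → Commute A (E.proj B))
    (s : SimpleFunc Ω ℂ) (u : K) : E.simpleIntegral s (A u) = A (E.simpleIntegral s u) := by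
  simp only [simpleIntegral, map_sum, map_smul]
  refine Finset.sum_congr rfl fun c _ => ?_
  rw [← mul_apply_eq_comp A, (hA _ (s.measurableSet_fiber c)).eq, mul_apply_eq_comp]

lemma norm_sq_simpleIntegral (s : SimpleFunc Ω ℂ) (u : K) :
    ‖E.simpleIntegral s u‖ ^ 2 = ∑ c ∈ s.range, ‖c‖ ^ 2 * ‖E.proj (s ⁻¹' {c}) u‖ ^ 2 := by
  have h : inner ℂ (E.simpleIntegral s u) (E.simpleIntegral s u) =
      ∑ c ∈ s.range, inner ℂ (c • E.proj (s ⁻¹' {c}) u) (c • E.proj (s ⁻¹' {c}) u) := by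
    rw [simpleIntegral, sum_inner]
    refine Finset.sum_congr rfl fun c hc => ?_
    rw [inner_sum, Finset.sum_eq_single_of_mem c hc]
    intro d _ hd
    rw [inner_smul_left, inner_smul_right, E.inner_proj_of_disjoint (s.measurableSet_fiber c)
      (s.measurableSet_fiber d), mul_zero, mul_zero]
    exact Disjoint.preimage _ (by simpa using hd.symm)
  simp only [inner_self_eq_ofReal, norm_smul, mul_pow] at h
  exact_mod_cast h

/-- The isometry behind the integral: distinct fibres of `s` give orthogonal vectors, so Pythagoras
turns the norm into an `L²` norm. -/
lemma enorm_simpleIntegral (s : SimpleFunc Ω ℂ) (u : K) :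
    ‖E.simpleIntegral s u‖ₑ = eLpNorm s 2 (E.scalarMeasure u) := by
  rw [eLpNorm_eq_lintegral_rpow_enorm_toReal two_ne_zero ENNReal.ofNat_ne_top]
  have h : ∫⁻ x, ‖s x‖ₑ ^ (2 : ℝ≥0∞).toReal ∂E.scalarMeasure u = ‖E.simpleIntegral s u‖ₑ ^ 2 := by
    have := (s.map fun c => ‖c‖ₑ ^ (2 : ℝ≥0∞).toReal).lintegral_eq_lintegral (E.scalarMeasure u)
    simp only [SimpleFunc.coe_map, Function.comp_apply] at this
    rw [this, SimpleFunc.map_lintegral, ← ofReal_norm,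
      ← ENNReal.ofReal_pow (norm_nonneg _), E.norm_sq_simpleIntegral,
      ENNReal.ofReal_sum_of_nonneg fun _ _ => by positivity]
    refine Finset.sum_congr rfl fun c _ => ?_
    rw [E.scalarMeasure_apply u (s.measurableSet_fiber c), ENNReal.ofReal_mul (by positivity),
      ENNReal.ofReal_pow (norm_nonneg _), ofReal_norm]
    simp
  rw [h, ← ENNReal.rpow_natCast, ← ENNReal.rpow_mul]
  simp

lemma norm_simpleIntegral (s : SimpleFunc Ω ℂ) (u : K)
    (hs : MemLp s 2 (E.scalarMeasure u)) : ‖E.simpleIntegral s u‖ = ‖hs.toLp s‖ := by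
  rw [Lp.norm_toLp, ← E.enorm_simpleIntegral, toReal_enorm]

lemma memLp_simpleFunc (s : SimpleFunc Ω ℂ) (u : K) : MemLp s 2 (E.scalarMeasure u) :=
  s.memLp_of_isFiniteMeasure _ _

/-- Simple functions are dense in `L²`, and the isometry carries Cauchy sequences to Cauchy
sequences in the complete space `K`. -/
lemma exists_hasIntegral {g : Ω → ℂ} {u : K} (hg : MemLp g 2 (E.scalarMeasure u)) :
    ∃ v, E.HasIntegral g u v := by
  have h := fun n : ℕ => hg.exists_simpleFunc_eLpNorm_sub_lt ENNReal.ofNat_ne_top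
    (ε := ((n : ℝ≥0∞) + 1)⁻¹) (by simp)
  choose s hs hs2 using h
  have h1 : Tendsto (fun n => eLpNorm (fun z => g z - s n z) 2 (E.scalarMeasure u)) atTop
      (𝓝 0) := by
    have h0 : Tendsto (fun n : ℕ => ((n : ℝ≥0∞) + 1)⁻¹) atTop (𝓝 0) := by
      have := ENNReal.tendsto_inv_nat_nhds_zero.comp (tendsto_add_atTop_nat 1)
      refine this.congr fun n => by simp
    exact tendsto_of_tendsto_of_tendsto_of_le_of_le tendsto_const_nhds h0 (fun _ => zero_le)
      fun n => (hs n).le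
  have h2 : Tendsto (fun n => (hs2 n).toLp (s n)) atTop (𝓝 (hg.toLp g)) := by
    rw [Lp.tendsto_Lp_iff_tendsto_eLpNorm'']
    refine h1.congr fun n => ?_
    rw [← eLpNorm_neg]
    congr 1; ext; simp
  have h3 : CauchySeq fun n => E.simpleIntegral (s n) u := by
    have hc := h2.cauchySeq
    rw [Metric.cauchySeq_iff] at hc ⊢
    intro ε hε
    obtain ⟨N, hN⟩ := hc ε hε
    refine ⟨N, fun m hm n hn => ?_⟩
    have := hN m hm n hn
    rw [dist_eq_norm, ← MemLp.toLp_sub] at this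
    rwa [dist_eq_norm, ← E.simpleIntegral_sub,
      E.norm_simpleIntegral _ _ (E.memLp_simpleFunc _ u)]
  obtain ⟨v, hv⟩ := cauchySeq_tendsto_of_complete h3
  exact ⟨v, hg, s, h1, hv⟩

namespace HasIntegral

variable {E} {g : Ω → ℂ} {u v : K}

lemma enorm_eq (h : E.HasIntegral g u v) : ‖v‖ₑ = eLpNorm g 2 (E.scalarMeasure u) := by
  obtain ⟨hg, s, h1, h2⟩ := h
  have h3 : Tendsto (fun n => (E.memLp_simpleFunc (s n) u).toLp (s n)) atTop (𝓝 (hg.toLp g)) := by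
    rw [Lp.tendsto_Lp_iff_tendsto_eLpNorm'']
    refine h1.congr fun n => ?_
    rw [← eLpNorm_neg]
    congr 1; ext; simp
  have h4 := h3.norm
  simp only [← E.norm_simpleIntegral] at h4
  have := tendsto_nhds_unique h2.norm h4
  rw [← ofReal_norm, this, Lp.norm_toLp, ENNReal.ofReal_toReal hg.eLpNorm_ne_top]

lemma sub_const (h : E.HasIntegral g u v) (c : ℂ) :
    E.HasIntegral (fun z => g z - c) u (v - c • u) := by
  obtain ⟨hg, s, h1, h2⟩ := h
  refine ⟨hg.sub (memLp_const c), fun n => s n - SimpleFunc.const Ω c, ?_, ?_⟩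
  · simpa using h1
  · simp only [simpleIntegral_sub, simpleIntegral_const]
    exact h2.sub_const _

/-- Since `A` commutes with `E`, the scalar measure of `A u` is at most `‖A‖ ^ 2` times that of `u`,
so the same simple functions still converge. -/
lemma map (h : E.HasIntegral g u v) {A : K →L[ℂ] K}
    (hA : ∀ B, MeasurableSet B → Commute A (E.proj B)) : E.HasIntegral g (A u) (A v) := by
  obtain ⟨hg, s, h1, h2⟩ := h
  have hle : E.scalarMeasure (A u) ≤ ENNReal.ofReal (‖A‖ ^ 2) • E.scalarMeasure u := by
    refine Measure.le_iff.2 fun B hB => ?_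
    rw [Measure.smul_apply, E.scalarMeasure_apply _ hB, E.scalarMeasure_apply _ hB, smul_eq_mul,
      ← ENNReal.ofReal_mul (by positivity), ← mul_pow, ← mul_apply_eq_comp, ← (hA B hB).eq]
    exact ENNReal.ofReal_le_ofReal (pow_le_pow_left₀ (norm_nonneg _) (A.le_opNorm _) 2)
  refine ⟨hg.of_measure_le_smul ENNReal.ofReal_ne_top hle, s, ?_, ?_⟩
  · set k := ENNReal.ofReal (‖A‖ ^ 2) ^ (1 / (2 : ℝ≥0∞)).toReal
    have h3 : Tendsto (fun n => k * eLpNorm (fun z => g z - s n z) 2 (E.scalarMeasure u)) atTop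
        (𝓝 0) := by
      have := ENNReal.Tendsto.const_mul (a := k) h1
        (Or.inr (ENNReal.rpow_ne_top_of_nonneg (by positivity) ENNReal.ofReal_ne_top))
      simpa using this
    refine tendsto_of_tendsto_of_tendsto_of_le_of_le tendsto_const_nhds h3 (fun _ => zero_le)
      fun n => ?_
    refine (eLpNorm_mono_measure _ hle).trans ?_
    rw [eLpNorm_smul_measure_of_ne_top ENNReal.ofNat_ne_top, smul_eq_mul]
  · simp only [E.simpleIntegral_map A hA]
    exact (A.continuous.tendsto v).comp h2

lemma eq_zero (h : E.HasIntegral g u v) (hg : g =ᵐ[E.scalarMeasure u] 0) : v = 0 := by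
  have := h.enorm_eq
  rwa [eLpNorm_congr_ae hg, eLpNorm_zero, enorm_eq_zero] at this

/-- Comparison in `L²` with the constant `ε`, whose integral at `u` is `ε • u`. -/
lemma mul_norm_le (h : E.HasIntegral g u v) {ε : ℝ}
    (hg : ∀ᵐ z ∂E.scalarMeasure u, ε ≤ ‖g z‖) (hε : 0 ≤ ε) : ε * ‖u‖ ≤ ‖v‖ := by
  have h1 := E.enorm_simpleIntegral (SimpleFunc.const Ω (ε : ℂ)) u
  have h2 : eLpNorm (SimpleFunc.const Ω (ε : ℂ)) 2 (E.scalarMeasure u) ≤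
      eLpNorm g 2 (E.scalarMeasure u) := by
    refine eLpNorm_mono_ae (hg.mono fun z hz => ?_)
    simpa [abs_of_nonneg hε] using hz
  rw [← h1, ← h.enorm_eq, enorm_le_iff_norm_le, E.simpleIntegral_const, norm_smul] at h2
  simpa [abs_of_nonneg hε] using h2

end HasIntegral

end SpectralMeasure

end TensorCalculus

namespace TensorCalculus

open MeasureTheory Filter Topology
open scoped ENNReal

/-! ### Rigidity: nilpotent parts vanish on eigenvectors. -/

section Nilpotent

variable {Ω K : Type*} [MeasurableSpace Ω] [NormedAddCommGroup K] [InnerProductSpace ℂ K]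
  [CompleteSpace K] {E : SpectralMeasure Ω K}

/-- If `∫ g dE` agrees with a nilpotent operator commuting with `E` at a vector `u`, then `u` lies
in the kernel of both. -/
lemma SpectralMeasure.HasIntegral.eq_zero_of_isNilpotent {g : Ω → ℂ} (hg : Measurable g) {u : K}
    {N : K →L[ℂ] K} (h : E.HasIntegral g u (N u)) (hN : IsNilpotent N)
    (hc : ∀ B, MeasurableSet B → Commute N (E.proj B)) :
    E.proj {z | g z ≠ 0} u = 0 ∧ N u = 0 := by
  have key : ∀ ε : ℝ, 0 < ε → E.scalarMeasure u {z | ε ≤ ‖g z‖} = 0 := by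
    intro ε hε
    set B := {z | ε ≤ ‖g z‖} with hBdef
    have hB : MeasurableSet B := measurableSet_le measurable_const hg.norm
    rw [E.scalarMeasure_eq_zero_iff u hB]
    -- Localise to the region `ε ≤ ‖g‖`. As `N` commutes with `E`, `∫ g dE` still acts as `N` on `v`
    -- and on every `N ^ k v`.
    set v := E.proj B u with hv
    have hv1 : E.HasIntegral g v (N v) := by
      have := h.map (A := E.proj B) fun C hC => E.proj_commute hB hC
      rwa [← mul_apply_eq_comp, ← (hc B hB).eq, mul_apply_eq_comp] at this
    have hvB : E.proj Bᶜ v = 0 := by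
      rw [hv, ← mul_apply_eq_comp, E.proj_mul_of_disjoint hB.compl hB disjoint_compl_left]
      rfl
    have hk : ∀ k, ε * ‖(N ^ k) v‖ ≤ ‖(N ^ (k + 1)) v‖ := by
      intro k
      have hck : ∀ C, MeasurableSet C → Commute (N ^ k) (E.proj C) :=
        fun C hC => (hc C hC).pow_left k
      have h1 := hv1.map hck
      rw [← mul_apply_eq_comp (N ^ k) N, ← pow_succ] at h1
      refine h1.mul_norm_le ?_ hε.le
      change E.scalarMeasure _ Bᶜ = 0
      rw [E.scalarMeasure_eq_zero_iff _ hB.compl, ← mul_apply_eq_comp, ← (hck _ hB.compl).eq,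
        mul_apply_eq_comp, hvB, map_zero]
    have hk2 : ∀ k, ε ^ k * ‖v‖ ≤ ‖(N ^ k) v‖ := by
      intro k
      induction k with
      | zero => simp
      | succ k ih =>
        calc ε ^ (k + 1) * ‖v‖ = ε * (ε ^ k * ‖v‖) := by ring
          _ ≤ ε * ‖(N ^ k) v‖ := by gcongr
          _ ≤ _ := hk k
    obtain ⟨m, hm⟩ := hN
    have := hk2 m
    rw [hm, zero_apply, norm_zero] at this
    have h2 : 0 < ε ^ m := pow_pos hε m
    exact norm_le_zero_iff.1 (le_of_not_gt fun h3 => absurd this (not_le.2 (mul_pos h2 h3)))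
  have hset : {z | g z ≠ 0} = ⋃ n : ℕ, {z | 1 / ((n : ℝ) + 1) ≤ ‖g z‖} := by
    ext z
    simp only [Set.mem_ofPred_eq, Set.mem_iUnion]
    constructor
    · intro hz
      obtain ⟨n, hn⟩ := exists_nat_one_div_lt (norm_pos_iff.2 hz)
      exact ⟨n, hn.le⟩
    · rintro ⟨n, hn⟩
      exact norm_pos_iff.1 (lt_of_lt_of_le (by positivity) hn)
  have h0 : E.scalarMeasure u {z | g z ≠ 0} = 0 := by
    rw [hset, measure_iUnion_null_iff]
    exact fun n => key _ (by positivity)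
  have hm : MeasurableSet {z | g z ≠ 0} := (hg (measurableSet_singleton 0)).compl
  exact ⟨(E.scalarMeasure_eq_zero_iff u hm).1 h0, h.eq_zero h0⟩

variable {r : ℕ} {F : SpectralMeasure (Fin r → ℂ) K} {T : Fin r → K →ₗ.[ℂ] K}
  {N : Fin r → K →L[ℂ] K}

/-- In a projector-nilpotent decomposition the nilpotent part kills the eigenvectors, and the
spectral measure is concentrated at the eigenvalue. -/
lemma IsProjectorNilpotent.apply_eigenvector (h : IsProjectorNilpotent T F N) {j : Fin r} {c : ℂ}
    {u : K} (hu : (u, c • u) ∈ (T j).graph) :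
    F.proj {z | z j ≠ c} u = 0 ∧ N j u = 0 := by
  -- Subtracting `c` cancels the eigenvalue: `∫ (z j - c) dE` sends `u` to `-N j u`.
  have h1 := ((h.decomp j _ _).1 hu).sub_const c
  have h2 : c • u - N j u - c • u = (-N j) u := by rw [neg_apply]; abel
  rw [h2] at h1
  have h3 := h1.eq_zero_of_isNilpotent (by fun_prop) (h.nilpotent j).neg
    fun B hB => (h.commute_proj j B hB).neg_left
  simpa [sub_ne_zero] using h3

end Nilpotent

/-! ### Resolutions of the identity and their atomic spectral measures. -/

section Resolution

variable {ι Ω K : Type*} [MeasurableSpace Ω] [NormedAddCommGroup K] [InnerProductSpace ℂ K]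
  [CompleteSpace K]

/-- A family of pairwise orthogonal projections which sum up to the identity. -/
structure IsResolution (P : ι → K →L[ℂ] K) : Prop where
  isStarProjection : ∀ i, IsStarProjection (P i)
  mul_eq_zero : ∀ {i j}, i ≠ j → P i * P j = 0
  hasSum : ∀ u, HasSum (fun i => P i u) u

lemma inner_starProjection_left {P : K →L[ℂ] K} (hP : IsStarProjection P) (u v : K) :
    inner ℂ (P u) v = inner ℂ u (P v) := by
  rw [← ContinuousLinearMap.adjoint_inner_right, ← ContinuousLinearMap.star_eq_adjoint,
    hP.isSelfAdjoint.star_eq]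

lemma starProjection_apply_self {P : K →L[ℂ] K} (hP : IsStarProjection P) (u : K) :
    P (P u) = P u := by rw [← mul_apply_eq_comp, hP.isIdempotentElem.eq]

/-- Pairwise orthogonal projections without a common zero form a resolution of the identity. -/
lemma IsResolution.of_total {P : ι → K →L[ℂ] K} (h1 : ∀ i, IsStarProjection (P i))
    (h2 : ∀ i j, i ≠ j → P i * P j = 0) (h3 : ∀ v, (∀ i, P i v = 0) → v = 0) :
    IsResolution P := by
  classical
  refine ⟨h1, fun {i j} => h2 i j, fun u => ?_⟩
  have hnorm : ∀ s : Finset ι, ‖∑ i ∈ s, P i u‖ ^ 2 = ∑ i ∈ s, ‖P i u‖ ^ 2 := by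
    intro s
    have h : inner ℂ (∑ i ∈ s, P i u) (∑ i ∈ s, P i u) = ∑ i ∈ s, inner ℂ (P i u) (P i u) := by
      rw [sum_inner]
      refine Finset.sum_congr rfl fun i hi => ?_
      rw [inner_sum, Finset.sum_eq_single_of_mem i hi]
      intro j _ hj
      rw [inner_starProjection_left (h1 i), ← mul_apply_eq_comp, h2 i j hj.symm, zero_apply,
        inner_zero_right]
    simp only [inner_self_eq_ofReal] at h
    exact_mod_cast h
  have hinner : ∀ s : Finset ι, inner ℂ (∑ i ∈ s, P i u) u = ((∑ i ∈ s, ‖P i u‖ ^ 2 : ℝ) : ℂ) := by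
    intro s
    rw [sum_inner, Complex.ofReal_sum]
    refine Finset.sum_congr rfl fun i _ => ?_
    rw [← starProjection_apply_self (h1 i), inner_starProjection_left (h1 i),
      inner_self_eq_ofReal, starProjection_apply_self (h1 i)]
  -- Bessel's inequality: `⟪∑ P i u, u⟫ = ‖∑ P i u‖ ^ 2`, then Cauchy–Schwarz.
  have hbound : ∀ s : Finset ι, ∑ i ∈ s, ‖P i u‖ ^ 2 ≤ ‖u‖ ^ 2 := by
    intro s
    have h := norm_inner_le_norm (𝕜 := ℂ) (∑ i ∈ s, P i u) u
    rw [hinner, ← hnorm, Complex.norm_real, norm_pow, norm_norm, sq] at h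
    rw [← hnorm]
    rcases (norm_nonneg (∑ i ∈ s, P i u)).eq_or_lt with h0 | h0
    · rw [← h0, zero_pow two_ne_zero]; positivity
    · exact pow_le_pow_left₀ h0.le (le_of_mul_le_mul_left h h0) 2
  have hsq : Summable fun i => ‖P i u‖ ^ 2 :=
    summable_of_sum_le (fun _ => sq_nonneg _) hbound
  have hs : Summable fun i => P i u := by
    rw [summable_iff_vanishing_norm] at hsq ⊢
    intro ε hε
    obtain ⟨s, hs⟩ := hsq (ε ^ 2) (by positivity)
    refine ⟨s, fun t ht => ?_⟩
    have := hs t ht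
    rw [← hnorm, norm_pow, norm_norm] at this
    exact lt_of_pow_lt_pow_left₀ 2 hε.le this
  obtain ⟨v, hv⟩ := hs
  -- Each `P i` gives the same value at `u` and at the sum `v`, so the totality hypothesis
  -- identifies them.
  have : u - v = 0 := h3 _ fun i => by
    rw [map_sub, sub_eq_zero]
    have h := hv.mapL (P i)
    have h' := hasSum_single (f := fun j => P i (P j u)) i fun j hj => by
      rw [← mul_apply_eq_comp, h2 i j hj.symm, zero_apply]
    rw [starProjection_apply_self (h1 i)] at h'
    exact h'.unique h
  exact (sub_eq_zero.1 this).symm ▸ hv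

namespace IsResolution

variable {P : ι → K →L[ℂ] K} (hP : IsResolution P)

include hP

lemma ext {u v : K} (h : ∀ i, P i u = P i v) : u = v :=
  (hP.hasSum u).unique (by simpa only [h] using hP.hasSum v)

lemma apply_apply_of_ne {i j : ι} (h : i ≠ j) (u : K) : P i (P j u) = 0 := by
  rw [← mul_apply_eq_comp, hP.mul_eq_zero h, zero_apply]

lemma apply_of_hasSum {x : ι → K} {v : K} (h : HasSum (fun i => P i (x i)) v) (i : ι) :
    P i v = P i (x i) := by
  have h' := hasSum_single (f := fun j => P i (P j (x j))) i fun j hj =>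
    hP.apply_apply_of_ne hj.symm _
  rw [starProjection_apply_self (hP.isStarProjection i)] at h'
  exact (h.mapL (P i)).unique h'

/-- Convergence comes for free in the converse: the terms are those of `∑ P i v`, which already sums
to `v`. Domain questions thus become componentwise equations. -/
lemma hasSum_iff {c : ι → ℂ} {u v : K} :
    HasSum (fun i => c i • P i u) v ↔ ∀ i, P i v = c i • P i u := by
  constructor
  · intro h i
    have := hP.apply_of_hasSum (x := fun i => c i • u) (by simpa using h) i
    simpa using this
  · intro h
    simpa only [h] using hP.hasSum v

lemma hasSum_inner (u v : K) : HasSum (fun i => inner ℂ (P i u) (P i v)) (inner ℂ u v) := by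
  have h := (hP.hasSum v).mapL (innerSL ℂ u)
  simp only [innerSL_apply_apply] at h
  refine h.congr_fun fun i => ?_
  rw [inner_starProjection_left (hP.isStarProjection i),
    starProjection_apply_self (hP.isStarProjection i)]

lemma hasSum_norm_sq (u : K) : HasSum (fun i => ‖P i u‖ ^ 2) (‖u‖ ^ 2) := by
  have h := hP.hasSum_inner u u
  simp only [inner_self_eq_ofReal] at h
  exact_mod_cast h

/-- The subspace of the vectors whose components outside of `S` vanish. -/
def subspace (_ : IsResolution P) (S : Set ι) : Submodule ℂ K :=
  ⨅ i ∈ Sᶜ, LinearMap.ker (P i : K →ₗ[ℂ] K)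

lemma mem_subspace {S : Set ι} {u : K} : u ∈ hP.subspace S ↔ ∀ i ∉ S, P i u = 0 := by
  simp [subspace]

lemma isClosed_subspace (S : Set ι) : IsClosed (hP.subspace S : Set K) := by
  have : (hP.subspace S : Set K) = ⋂ i ∈ Sᶜ, {u | P i u = 0} := by
    ext u
    simp [mem_subspace]
  rw [this]
  exact isClosed_biInter fun i _ => isClosed_eq (P i).continuous continuous_const

/-- The projection `∑ i ∈ S, P i`. -/
noncomputable def projOn (S : Set ι) : K →L[ℂ] K :=
  (hP.subspace S).topologicalClosure.starProjection

open scoped Classical in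
lemma apply_projOn (S : Set ι) (i : ι) (u : K) :
    P i (hP.projOn S u) = if i ∈ S then P i u else 0 := by
  -- The partial sum over `S` converges by unconditional summability; it is then identified as the
  -- orthogonal projection of `u`.
  have hsum : Summable (S.indicator fun i => P i u) := (hP.hasSum u).summable.indicator S
  obtain ⟨s, hs⟩ := hsum
  have hs1 : ∀ i, P i s = if i ∈ S then P i u else 0 := by
    intro i
    have := hP.apply_of_hasSum (x := fun i => if i ∈ S then u else 0) (v := s) (by
      convert hs using 2 with i
      by_cases hi : i ∈ S <;> simp [hi]) i
    rw [this]
    by_cases hi : i ∈ S <;> simp [hi]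
  have hproj : hP.projOn S u = s := by
    refine Submodule.eq_starProjection_of_mem_of_inner_eq_zero ?_ fun w hw => ?_
    · refine Submodule.le_topologicalClosure _ (hP.mem_subspace.2 fun i hi => ?_)
      rw [hs1, if_neg hi]
    · rw [(hP.isClosed_subspace S).submodule_topologicalClosure_eq, hP.mem_subspace] at hw
      refine (hP.hasSum_inner (u - s) w).unique ?_
      convert hasSum_zero with i
      by_cases hi : i ∈ S
      · rw [map_sub, hs1, if_pos hi, sub_self, inner_zero_left]
      · rw [hw i hi, inner_zero_right]
  rw [hproj, hs1]

/-- The spectral measure `B ↦ ∑ P i` with the sum over those `i` with `p i ∈ B`. -/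
noncomputable def spectralMeasure (p : ι → Ω) : SpectralMeasure Ω K where
  proj B := hP.projOn (p ⁻¹' B)
  isStarProjection B _ := isStarProjection_starProjection
  proj_univ := by
    ext u
    exact hP.ext fun i => by simp [apply_projOn]
  hasSum_iUnion B _ hd u := by
    -- Adding the complement of the union as index `none` makes the projections a resolution, so
    -- countable additivity follows from `of_total`. The `none` term vanishes on the range of the
    -- projection of the union.
    let S : Option ℕ → Set Ω := fun n => n.elim (⋃ n, B n)ᶜ B
    have hS : ∀ m n, m ≠ n → Disjoint (S m) (S n) := by
      rintro (_ | m) (_ | n) hmn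
      · exact absurd rfl hmn
      · exact Disjoint.mono_right (Set.subset_iUnion B n) disjoint_compl_left
      · exact Disjoint.mono_left (Set.subset_iUnion B m) disjoint_compl_right
      · exact hd fun h => hmn (congrArg some h)
    have hQ : IsResolution fun n => hP.projOn (p ⁻¹' S n) := by
      refine .of_total (fun n => isStarProjection_starProjection) (fun m n hmn => ?_)
        fun v hv => hP.ext fun i => ?_
      · ext v
        refine hP.ext fun i => ?_
        rw [mul_apply_eq_comp, apply_projOn, apply_projOn]
        by_cases h1 : p i ∈ S m
        · simp [(hS m n hmn).notMem_of_mem_left h1]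
        · simp [h1]
      · obtain ⟨n, hn⟩ : ∃ n, p i ∈ S n := by
          by_cases h : p i ∈ ⋃ n, B n
          · obtain ⟨n, hn⟩ := Set.mem_iUnion.1 h
            exact ⟨some n, hn⟩
          · exact ⟨none, h⟩
        have := hP.apply_projOn (p ⁻¹' S n) i v
        rw [hv n, Set.mem_preimage, if_pos hn] at this
        rw [← this]
    have h := hQ.hasSum (hP.projOn (p ⁻¹' ⋃ n, B n) u)
    rw [← (Option.some_injective ℕ).hasSum_iff] at h
    · refine h.congr_fun fun n => hP.ext fun i => ?_
      change _ = P i (hP.projOn (p ⁻¹' B n) _)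
      rw [apply_projOn, apply_projOn, apply_projOn]
      by_cases hi : i ∈ p ⁻¹' B n
      · rw [if_pos hi, if_pos hi]
        have hi' : i ∈ p ⁻¹' ⋃ n, B n := Set.mem_iUnion_of_mem n hi
        rw [if_pos hi']
      · rw [if_neg hi, if_neg hi]
    · rintro (_ | n) hn
      · refine hP.ext fun i => ?_
        rw [apply_projOn, apply_projOn, map_zero]
        by_cases hi : i ∈ p ⁻¹' ⋃ n, B n
        · exact if_neg fun h => h hi
        · rw [if_neg hi, ite_self]
      · exact absurd ⟨n, rfl⟩ hn

open scoped Classical in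
lemma spectralMeasure_proj_mul (p : ι → Ω) (B : Set Ω) (i : ι) :
    (hP.spectralMeasure p).proj B * P i = if p i ∈ B then P i else 0 := by
  ext u
  refine hP.ext fun j => ?_
  change P j (hP.projOn (p ⁻¹' B) (P i u)) = _
  rw [apply_projOn]
  by_cases hij : j = i
  · subst hij
    by_cases h : p j ∈ B <;> simp [h]
  · by_cases h : p i ∈ B <;> simp [h, hP.apply_apply_of_ne hij]

variable {E : SpectralMeasure Ω K} {p : ι → Ω}

open scoped Classical in
-- The product is self-adjoint in either case, so taking adjoints reverses its order.
lemma commute_proj {B : Set Ω} (hB : MeasurableSet B) {i : ι}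
    (h : E.proj B * P i = if p i ∈ B then P i else 0) : Commute (P i) (E.proj B) := by
  have h2 := congrArg star h
  rw [star_mul, (hP.isStarProjection i).isSelfAdjoint.star_eq,
    (E.isStarProjection B hB).isSelfAdjoint.star_eq] at h2
  rw [Commute, SemiconjBy, h, h2]
  split_ifs
  · exact (hP.isStarProjection i).isSelfAdjoint.star_eq
  · exact star_zero _

open scoped Classical in
lemma scalarMeasure_eq_sum (hE : ∀ B, MeasurableSet B → ∀ i,
    E.proj B * P i = if p i ∈ B then P i else 0) (u : K) :
    E.scalarMeasure u = Measure.sum fun i => ENNReal.ofReal (‖P i u‖ ^ 2) • Measure.dirac (p i) := by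
  ext B hB
  have h := hP.hasSum_norm_sq (E.proj B u)
  rw [E.scalarMeasure_apply u hB, Measure.sum_apply _ hB, ← h.tsum_eq,
    ENNReal.ofReal_tsum_of_nonneg (fun _ => sq_nonneg _) h.summable]
  refine tsum_congr fun i => ?_
  rw [← mul_apply_eq_comp, (hP.commute_proj hB (hE B hB i)).eq, hE B hB i, Measure.smul_apply,
    Measure.dirac_apply' _ hB]
  by_cases hi : p i ∈ B <;> simp [hi]

open scoped Classical in
/-- The integral with respect to a spectral measure with atoms `P i` at `p i`. -/
theorem hasIntegral_iff [MeasurableSingletonClass Ω] (hE : ∀ B, MeasurableSet B → ∀ i,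
    E.proj B * P i = if p i ∈ B then P i else 0) (g : Ω → ℂ) (u v : K) :
    E.HasIntegral g u v ↔ HasSum (fun i => g (p i) • P i u) v := by
  have mp : ∀ v, E.HasIntegral g u v → HasSum (fun i => g (p i) • P i u) v := by
    intro v h
    refine hP.hasSum_iff.2 fun i => ?_
    -- Apply `P i`: the scalar measure of `P i u` lives at `p i`, where `g - g (p i)` vanishes.
    have h1 := (h.map fun B hB => hP.commute_proj hB (hE B hB i)).sub_const (g (p i))
    refine sub_eq_zero.1 (h1.eq_zero ?_)
    have h2 : E.scalarMeasure (P i u) {p i}ᶜ = 0 := by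
      have hm : MeasurableSet ({p i}ᶜ : Set Ω) := (measurableSet_singleton _).compl
      rw [E.scalarMeasure_eq_zero_iff _ hm, ← mul_apply_eq_comp, hE _ hm]
      simp
    filter_upwards [compl_mem_ae_iff.2 h2] with z hz
    rw [compl_compl, Set.mem_singleton_iff] at hz
    simp [hz]
  refine ⟨mp v, fun h => ?_⟩
  have hsq := hP.hasSum_norm_sq v
  simp only [hP.hasSum_iff.1 h] at hsq
  have hmem : MemLp g 2 (E.scalarMeasure u) := by
    refine ⟨?_, ?_⟩
    · have hc : (Function.support fun i => P i u).Countable :=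
        (hP.hasSum u).summable.countable_support
      set C := p '' (Function.support fun i => P i u)
      have hC : C.Countable := hc.image p
      have hm : Measurable (C.indicator g) := by
        refine Measurable.measurable_of_countable_ne (measurable_const (a := (0 : ℂ)))
          (hC.mono fun z hz => ?_)
        by_contra hzC
        exact hz (Set.indicator_of_notMem hzC g).symm
      refine ⟨C.indicator g, hm.stronglyMeasurable, ?_⟩
      have h2 : E.scalarMeasure u Cᶜ = 0 := by
        rw [E.scalarMeasure_eq_zero_iff _ hC.measurableSet.compl]
        refine hP.ext fun i => ?_
        have hm' := hC.measurableSet.compl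
        rw [← mul_apply_eq_comp, (hP.commute_proj hm' (hE _ hm' i)).eq, hE _ hm', map_zero]
        by_cases hi : P i u = 0
        · split_ifs <;> simp [hi]
        · rw [if_neg, zero_apply]
          exact fun h => h ⟨i, hi, rfl⟩
      filter_upwards [compl_mem_ae_iff.2 h2] with z hz
      rw [compl_compl] at hz
      rw [Set.indicator_of_mem hz]
    -- The squared `L²` norm is `∑ ‖g (p i)‖ ^ 2 * ‖P i u‖ ^ 2 = ∑ ‖P i v‖ ^ 2`, which is finite.
    · rw [eLpNorm_lt_top_iff_lintegral_rpow_enorm_lt_top two_ne_zero ENNReal.ofNat_ne_top,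
        hP.scalarMeasure_eq_sum hE, lintegral_sum_measure]
      simp only [lintegral_smul_measure, lintegral_dirac, smul_eq_mul]
      convert hsq.summable.tsum_ofReal_lt_top using 3 with i
      rw [norm_smul, mul_pow, ENNReal.ofReal_mul (by positivity), mul_comm,
        ENNReal.ofReal_pow (norm_nonneg _) 2, ofReal_norm]
      simp
  obtain ⟨w, hw⟩ := E.exists_hasIntegral hmem
  rwa [h.unique (mp w hw)]

end IsResolution

end Resolution

end TensorCalculus

namespace TensorCalculus

open MeasureTheory Filter Topology
open scoped LinearPMap

/-! ### The functional calculus of a diagonal tuple. -/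

section Calculus

variable {r : ℕ} {K : Type*} [NormedAddCommGroup K] [InnerProductSpace ℂ K] [CompleteSpace K]

omit [CompleteSpace K] in
-- The nilpotency class of `0` is at most `1` (it is `0` if `K` is trivial), so no order `1 ≤ q j <
-- ν j` exists.
lemma admissible_zero_of_ne_empty {A : Finset (Fin r)} (hA : A ≠ ∅) :
    admissible (fun _ => (0 : K →L[ℂ] K)) A = ∅ := by
  obtain ⟨j, hj⟩ := Finset.nonempty_iff_ne_empty.2 hA
  have h : nilpotencyClass (0 : K →L[ℂ] K) ≤ 1 := Nat.sInf_le (by simp)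
  rw [admissible, Fintype.piFinset_eq_empty]
  exact ⟨j, by simp [hj, h]⟩

omit [CompleteSpace K] in
lemma admissible_zero_empty : admissible (fun _ : Fin r => (0 : K →L[ℂ] K)) ∅ = {0} := by
  ext q
  simp [admissible, funext_iff]

lemma mixedDeriv_zero (f : (Fin r → ℂ) → ℂ) : mixedDeriv 0 f = f := by
  simp only [mixedDeriv, Pi.zero_apply, Function.iterate_zero, id]
  induction List.finRange r with
  | nil => rfl
  | cons a l ih => simp

omit [CompleteSpace K] in
lemma nilpotentPower_zero (N : Fin r → K →L[ℂ] K) : nilpotentPower N 0 = 1 := by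
  simp [nilpotentPower]

/-- Without nilpotent part the unified compact formula is the spectral integral `∫ f dE`. -/
lemma compactFormula_zero_iff (E : SpectralMeasure (Fin r → ℂ) K) (f : (Fin r → ℂ) → ℂ) (u w : K) :
    (∃ v : (Fin r → ℕ) → K,
      (∀ A, ∀ q ∈ admissible (fun _ => (0 : K →L[ℂ] K)) A,
        E.HasIntegral (fun z => mixedDeriv q f z / ∏ j, (q j).factorial)
          (nilpotentPower (fun _ => (0 : K →L[ℂ] K)) q u) (v q)) ∧
      w = ∑ A : Finset (Fin r), ∑ q ∈ admissible (fun _ => (0 : K →L[ℂ] K)) A, v q) ↔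
    E.HasIntegral f u w := by
  have hsum : ∀ v : (Fin r → ℕ) → K, ∑ A : Finset (Fin r),
      ∑ q ∈ admissible (fun _ => (0 : K →L[ℂ] K)) A, v q = v 0 := by
    intro v
    rw [Finset.sum_eq_single_of_mem ∅ (Finset.mem_univ _) fun A _ hA => by
      rw [admissible_zero_of_ne_empty hA, Finset.sum_empty], admissible_zero_empty,
      Finset.sum_singleton]
  have hall : ∀ v : (Fin r → ℕ) → K, (∀ A, ∀ q ∈ admissible (fun _ => (0 : K →L[ℂ] K)) A,
      E.HasIntegral (fun z => mixedDeriv q f z / ∏ j, (q j).factorial)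
        (nilpotentPower (fun _ => (0 : K →L[ℂ] K)) q u) (v q)) ↔ E.HasIntegral f u (v 0) := by
    intro v
    have h0 : E.HasIntegral (fun z => mixedDeriv 0 f z / ∏ j : Fin r, ((0 : Fin r → ℕ) j).factorial)
        (nilpotentPower (fun _ : Fin r => (0 : K →L[ℂ] K)) 0 u) (v 0) ↔ E.HasIntegral f u (v 0) := by
      rw [mixedDeriv_zero, nilpotentPower_zero]
      simp
    constructor
    · intro h
      exact h0.1 (h ∅ 0 (by rw [admissible_zero_empty]; simp))
    · intro h A q hq
      by_cases hA : A = ∅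
      · rw [hA, admissible_zero_empty, Finset.mem_singleton] at hq
        subst hq
        exact h0.2 h
      · rw [admissible_zero_of_ne_empty hA] at hq
        simp at hq
  simp only [hsum, hall]
  constructor
  · rintro ⟨v, h1, rfl⟩
    exact h1
  · intro h
    exact ⟨fun _ => w, h, rfl⟩

variable {ι : Type*} {P : ι → K →L[ℂ] K} {p : ι → Fin r → ℂ} {T : Fin r → K →ₗ.[ℂ] K}

/-- The operators `T j = ∑ i, p i j • P i` have a projector-nilpotent decomposition. -/
lemma IsResolution.isProjectorNilpotent (hP : IsResolution P)
    (hT : ∀ j u v, (u, v) ∈ (T j).graph ↔ HasSum (fun i => p i j • P i u) v) :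
    IsProjectorNilpotent T (hP.spectralMeasure p) 0 where
  decomp j u v := by
    rw [hT, hP.hasIntegral_iff fun B _ i => hP.spectralMeasure_proj_mul p B i]
    simp
  nilpotent _ := ⟨1, by simp⟩
  commute _ _ := Commute.zero_left _
  commute_proj _ _ _ := Commute.zero_left _

lemma IsResolution.graph_apply (hP : IsResolution P)
    (hT : ∀ j u v, (u, v) ∈ (T j).graph ↔ HasSum (fun i => p i j • P i u) v) (i : ι) (j : Fin r)
    (u : K) : (P i u, p i j • P i u) ∈ (T j).graph := by
  rw [hT, hP.hasSum_iff]
  intro k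
  by_cases hk : k = i
  · subst hk
    rw [map_smul]
  · rw [map_smul, hP.apply_apply_of_ne hk, smul_zero, smul_zero]

/-- In every projector-nilpotent decomposition of `T j = ∑ i, p i j • P i` the nilpotent parts
vanish. -/
lemma IsResolution.nilpotent_eq_zero (hP : IsResolution P)
    (hT : ∀ j u v, (u, v) ∈ (T j).graph ↔ HasSum (fun i => p i j • P i u) v)
    {E : SpectralMeasure (Fin r → ℂ) K} {N : Fin r → K →L[ℂ] K}
    (h : IsProjectorNilpotent T E N) (j : Fin r) : N j = 0 := by
  ext u
  have h1 := (hP.hasSum u).mapL (N j)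
  simp only [(h.apply_eigenvector (hP.graph_apply hT _ j u)).2] at h1
  exact h1.unique hasSum_zero

open scoped Classical in
/-- In every projector-nilpotent decomposition of `T j = ∑ i, p i j • P i` the spectral measure
has the atoms `P i` at `p i`. -/
lemma IsResolution.proj_mul_of_isProjectorNilpotent (hP : IsResolution P)
    (hT : ∀ j u v, (u, v) ∈ (T j).graph ↔ HasSum (fun i => p i j • P i u) v)
    {E : SpectralMeasure (Fin r → ℂ) K} {N : Fin r → K →L[ℂ] K}
    (h : IsProjectorNilpotent T E N) {B : Set (Fin r → ℂ)} (hB : MeasurableSet B) (i : ι) :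
    E.proj B * P i = if p i ∈ B then P i else 0 := by
  ext u
  have h0 : E.scalarMeasure (P i u) {p i}ᶜ = 0 := by
    -- Coordinatewise concentration suffices: the complement of the point is a finite union of the
    -- sets `z j ≠ p i j`.
    have hU : ({p i}ᶜ : Set (Fin r → ℂ)) = ⋃ j, {z | z j ≠ p i j} := by
      ext z
      simp [funext_iff]
    rw [hU, measure_iUnion_null_iff]
    intro j
    have hm : MeasurableSet {z : Fin r → ℂ | z j ≠ p i j} :=
      (measurableSet_eq_fun (measurable_pi_apply j) measurable_const).compl
    rw [E.scalarMeasure_eq_zero_iff _ hm]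
    exact (h.apply_eigenvector (hP.graph_apply hT i j u)).1
  have hnull : ∀ C, MeasurableSet C → p i ∉ C → E.proj C (P i u) = 0 := fun C hC hi => by
    rw [← E.scalarMeasure_eq_zero_iff _ hC]
    refine measure_mono_null (fun z hz => ?_) h0
    rintro rfl
    exact hi hz
  by_cases hi : p i ∈ B
  · have h1 := E.proj_union hB hB.compl disjoint_compl_right
    rw [Set.union_compl_self, E.proj_univ] at h1
    have h2 := congrArg (· (P i u)) h1
    simp only [one_apply_eq_self, add_apply, hnull _ hB.compl (fun h => h hi), add_zero] at h2
    simp [hi, ← h2]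
  · simp [hi, hnull B hB hi]

/-- The functional calculus of `T j = ∑ i, p i j • P i`. -/
theorem IsResolution.isCalculus_iff (hP : IsResolution P)
    (hT : ∀ j u v, (u, v) ∈ (T j).graph ↔ HasSum (fun i => p i j • P i u) v)
    (f : (Fin r → ℂ) → ℂ) (F : K →ₗ.[ℂ] K) :
    IsCalculus f T F ↔ ∀ u w, (u, w) ∈ F.graph ↔ HasSum (fun i => f (p i) • P i u) w := by
  constructor
  · rintro ⟨E, N, h, hF⟩ u w
    obtain rfl : N = fun _ => 0 := funext (hP.nilpotent_eq_zero hT h)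
    rw [hF, compactFormula_zero_iff,
      hP.hasIntegral_iff fun B hB i => hP.proj_mul_of_isProjectorNilpotent hT h hB i]
  · intro hF
    refine ⟨hP.spectralMeasure p, fun _ => 0, hP.isProjectorNilpotent hT, fun u w => ?_⟩
    rw [hF, compactFormula_zero_iff,
      hP.hasIntegral_iff fun B _ i => hP.spectralMeasure_proj_mul p B i]

/-- The operator `∑ i, c i • P i` on its natural domain. -/
lemma IsResolution.exists_linearPMap (hP : IsResolution P) (c : ι → ℂ) :
    ∃ F : K →ₗ.[ℂ] K, ∀ u w, (u, w) ∈ F.graph ↔ HasSum (fun i => c i • P i u) w := by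
  let G : Submodule ℂ (K × K) :=
    { carrier := {x | ∀ i, P i x.2 = c i • P i x.1}
      add_mem' := fun {a b} ha hb i => by
        simp only [Prod.fst_add, Prod.snd_add, map_add, smul_add, ha i, hb i]
      zero_mem' := fun i => by simp
      smul_mem' := fun a b hb i => by
        simp only [Prod.smul_fst, Prod.smul_snd, map_smul, hb i, smul_comm a] }
  refine ⟨G.toLinearPMap, fun u w => ?_⟩
  rw [Submodule.toLinearPMap_graph_eq, hP.hasSum_iff]
  · rfl
  · rintro ⟨u, w⟩ h rfl
    exact hP.ext fun i => by simpa using h i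

end Calculus

end TensorCalculus

namespace TensorCalculus

open MeasureTheory Filter Topology
open scoped LinearPMap

/-! ### Joint eigenprojections diagonalise the lifted operators. -/

section Tensor

variable {r : ℕ} {H : Fin r → Type*} [∀ j, NormedAddCommGroup (H j)]
  [∀ j, InnerProductSpace ℂ (H j)]

lemma elem_eq_zero {u : ∀ j, H j} {j : Fin r} (h : u j = 0) : elem u = 0 := by
  rw [← norm_eq_zero, norm_elem]
  exact Finset.prod_eq_zero (Finset.mem_univ j) (by rw [h, norm_zero])

/-- Continuous operators agreeing on the elementary tensors are equal. -/
lemma ext_elem {F : Type*} [NormedAddCommGroup F] [NormedSpace ℂ F]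
    {A B : HilbertTensor H →L[ℂ] F} (h : ∀ u, A (elem u) = B (elem u)) : A = B := by
  refine DFunLike.coe_injective (UniformSpace.Completion.denseRange_coe.equalizer A.continuous
    B.continuous (funext fun t => ?_))
  simp only [Function.comp_apply]
  induction t using algTensor_induction with
  | h1 c u =>
    rw [UniformSpace.Completion.coe_smul, map_smul, map_smul]
    exact congrArg (c • ·) (h u)
  | h2 s t hs ht => rw [UniformSpace.Completion.coe_add, map_add, map_add, hs, ht]

lemma tensorMap_mul (A B : ∀ j, H j →L[ℂ] H j) :
    tensorMap A * tensorMap B = tensorMap fun j => A j * B j :=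
  ext_elem fun u => by simp [tensorMap_elem]

/-- A vector orthogonal to the elementary tensors with factors in total sets is zero. -/
lemma eq_zero_of_inner_elem_of_total (S : ∀ j, Set (H j))
    (hS : ∀ j, (Submodule.span ℂ (S j)).topologicalClosure = ⊤) (v : HilbertTensor H)
    (h : ∀ w : ∀ j, H j, (∀ j, w j ∈ S j) → inner ℂ (elem w) v = 0) : v = 0 := by
  classical
  -- The slots in `s` may hold arbitrary vectors. Slots are released one at a time, by linearity and
  -- continuity in that slot.
  have key : ∀ s : Finset (Fin r), ∀ w : ∀ j, H j, (∀ j ∉ s, w j ∈ S j) →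
      inner ℂ (elem w) v = 0 := by
    intro s
    induction s using Finset.induction_on with
    | empty => exact fun w hw => h w fun j => hw j (Finset.notMem_empty j)
    | insert i s hi ih =>
      intro w hw
      let V : Submodule ℂ (H i) :=
        { carrier := {x | inner ℂ (elem (Function.update w i x)) v = 0}
          add_mem' := fun {a b} ha hb => by
            simp only [Set.mem_ofPred_eq] at ha hb ⊢
            rw [elem_update_add, inner_add_left, ha, hb, add_zero]
          zero_mem' := by
            simp only [Set.mem_ofPred_eq]
            rw [elem_eq_zero (j := i) (by simp), inner_zero_left]
          smul_mem' := fun c x hx => by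
            simp only [Set.mem_ofPred_eq] at hx ⊢
            rw [elem_update_smul, inner_smul_left, hx, mul_zero] }
      have hV : IsClosed (V : Set (H i)) :=
        isClosed_singleton.preimage ((continuous_elem_update w i).inner continuous_const)
      have hle : (Submodule.span ℂ (S i)).topologicalClosure ≤ V := by
        refine Submodule.topologicalClosure_minimal _ (Submodule.span_le.2 fun x hx => ?_) hV
        refine ih _ fun j hj => ?_
        by_cases hji : j = i
        · subst hji
          simpa using hx
        · rw [Function.update_of_ne hji]
          exact hw j (by simp [hji, hj])
      rw [hS i] at hle
      have : w i ∈ V := hle Submodule.mem_top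
      simpa [V] using this
  exact eq_zero_of_inner_elem v fun w => key Finset.univ w (by simp)

variable [∀ j, CompleteSpace (H j)]

lemma isStarProjection_tensorMap {A : ∀ j, H j →L[ℂ] H j} (hA : ∀ j, IsStarProjection (A j)) :
    IsStarProjection (tensorMap A) := by
  refine ⟨?_, ?_⟩
  · rw [IsIdempotentElem, tensorMap_mul]
    simp only [(hA _).isIdempotentElem.eq]
  · rw [ContinuousLinearMap.isSelfAdjoint_iff', eq_comm]
    refine ext_elem fun u => ?_
    refine sub_eq_zero.1 (eq_zero_of_inner_elem _ fun w => ?_)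
    rw [inner_sub_right, ContinuousLinearMap.adjoint_inner_right, tensorMap_elem, tensorMap_elem,
      inner_elem, inner_elem, sub_eq_zero]
    exact Finset.prod_congr rfl fun j _ => (inner_starProjection_left (hA j) _ _).symm

variable {X : ∀ j, H j →ₗ.[ℂ] H j}

/-- The joint eigenprojection `P_{X 0}(z 0) ⊗ ⋯ ⊗ P_{X (r - 1)}(z (r - 1))`. -/
noncomputable def jointProj (X : ∀ j, H j →ₗ.[ℂ] H j) (z : ∀ j, opSpectrum (X j)) :
    HilbertTensor H →L[ℂ] HilbertTensor H :=
  tensorMap fun j => eigenProj (X j) (z j)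

variable (hX : ∀ j, IsNormalOp (X j)) (hpp : ∀ j, HasPurePointSpectrum (X j))

include hX

include hpp in
/-- The joint eigenprojections of normal operators with pure point spectrum form a resolution of
the identity. -/
theorem isResolution_jointProj : IsResolution (jointProj X) := by
  have hstar : ∀ z, IsStarProjection (jointProj X z) := fun z =>
    isStarProjection_tensorMap fun j => isStarProjection_starProjection
  refine .of_total hstar (fun z z' hz => ext_elem fun u => ?_) fun v hv => ?_
  · obtain ⟨j, hj⟩ := Function.ne_iff.1 hz
    rw [mul_apply_eq_comp, jointProj, jointProj, tensorMap_elem, tensorMap_elem, zero_apply]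
    refine elem_eq_zero (j := j) ?_
    exact (hX j).eigenProj_eq_zero (fun h => hj (Subtype.ext h)) ((hX j).eigenProj_mem _ _)
  · refine eq_zero_of_inner_elem_of_total (fun j => ⋃ z, (opEigenspace (X j) z : Set (H j)))
      (fun j => ?_) v fun w hw => ?_
    · rw [← Submodule.iSup_eq_span]
      exact (hX j).topologicalClosure_iSup_opEigenspace (hpp j)
    · simp only [Set.mem_iUnion] at hw
      choose z hz using hw
      -- The index set contains only spectral values; an eigenspace at any other value is zero, so
      -- the tensor vanishes.
      by_cases hspec : ∀ j, z j ∈ opSpectrum (X j)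
      · have h1 : jointProj X (fun j => ⟨z j, hspec j⟩) (elem w) = elem w := by
          rw [jointProj, tensorMap_elem]
          exact congrArg elem (funext fun j => (hX j).eigenProj_eq_self (hz j))
        rw [← h1, inner_starProjection_left (hstar _), hv, inner_zero_right]
      · push Not at hspec
        obtain ⟨j, hj⟩ := hspec
        rw [elem_eq_zero (IsNormalOp.eq_zero_of_notMem_opSpectrum hj (hz j)), inner_zero_left]

/-- The relation is linear and closed in `x`, so it is enough to check the generators of the graph,
where `eigenProj_graph` handles slot `j`. -/
lemma jointProj_liftGraph (z : ∀ j, opSpectrum (X j)) (j : Fin r)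
    {x : HilbertTensor H × HilbertTensor H} (hx : x ∈ (liftGraph j (X j)).topologicalClosure) :
    jointProj X z x.2 = (z j : ℂ) • jointProj X z x.1 := by
  let C : Submodule ℂ (HilbertTensor H × HilbertTensor H) :=
    LinearMap.ker (((jointProj X z).comp (ContinuousLinearMap.snd ℂ _ _) -
      (z j : ℂ) • (jointProj X z).comp (ContinuousLinearMap.fst ℂ _ _) :
        HilbertTensor H × HilbertTensor H →L[ℂ] HilbertTensor H) : _ →ₗ[ℂ] HilbertTensor H)
  have hC : IsClosed (C : Set (HilbertTensor H × HilbertTensor H)) :=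
    ContinuousLinearMap.isClosed_ker _
  have hle : (liftGraph j (X j)).topologicalClosure ≤ C := by
    refine Submodule.topologicalClosure_minimal _ (Submodule.span_le.2 ?_) hC
    rintro _ ⟨u, y, huy, rfl⟩
    change jointProj X z (elem (Function.update u j y)) - (z j : ℂ) • jointProj X z (elem u) = 0
    rw [jointProj, tensorMap_elem, tensorMap_elem, sub_eq_zero]
    have h1 : (fun i => eigenProj (X i) (z i) (Function.update u j y i)) =
        Function.update (fun i => eigenProj (X i) (z i) (u i)) j
          ((z j : ℂ) • eigenProj (X j) (z j) (u j)) := by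
      funext i
      by_cases hij : i = j
      · subst hij
        simpa using (hX i).eigenProj_graph _ huy
      · simp [hij]
    rw [h1, elem_update_smul, Function.update_eq_self]
  exact sub_eq_zero.1 (hle hx)

/-- On an elementary tensor the projection puts an eigenvector in slot `j`, giving a generator of
the graph; linearity, density and closedness do the rest. -/
lemma jointProj_mem_liftGraph (z : ∀ j, opSpectrum (X j)) (j : Fin r) (u : HilbertTensor H) :
    (jointProj X z u, (z j : ℂ) • jointProj X z u) ∈ (liftGraph j (X j)).topologicalClosure := by
  set V := (liftGraph j (X j)).topologicalClosure
  induction u using UniformSpace.Completion.induction_on with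
  | hp =>
    have hc : Continuous fun u => (jointProj X z u, (z j : ℂ) • jointProj X z u) :=
      (jointProj X z).continuous.prodMk ((jointProj X z).continuous.const_smul (z j : ℂ))
    exact (Submodule.isClosed_topologicalClosure (liftGraph j (X j))).preimage hc
  | ih t =>
    induction t using algTensor_induction with
    | h1 c u =>
      rw [UniformSpace.Completion.coe_smul, map_smul, smul_comm]
      rw [← Prod.smul_mk]
      refine V.smul_mem c (Submodule.le_topologicalClosure _ (Submodule.subset_span ?_))
      have h1 : jointProj X z ((algTprod u : AlgTensor H) : HilbertTensor H) =
        elem fun i => eigenProj (X i) (z i) (u i) := tensorMap_elem _ u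
      rw [h1]
      refine ⟨fun i => eigenProj (X i) (z i) (u i), (z j : ℂ) • eigenProj (X j) (z j) (u j),
        mem_opEigenspace.1 ((hX j).eigenProj_mem (z j) (u j)), ?_⟩
      rw [elem_update_smul, Function.update_eq_self]
    | h2 s t hs ht =>
      rw [UniformSpace.Completion.coe_add, map_add, smul_add]
      exact V.add_mem hs ht

include hpp in
/-- The lifted operators in terms of the joint eigenprojections. -/
theorem lifted_graph_iff (j : Fin r) (u v : HilbertTensor H) :
    (u, v) ∈ (lifted X j).graph ↔
      HasSum (fun z : ∀ j, opSpectrum (X j) => (z j : ℂ) • jointProj X z u) v := by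
  have hP := isResolution_jointProj hX hpp
  rw [lifted, lift_graph j (hX j)]
  constructor
  · intro h
    exact hP.hasSum_iff.2 fun z => jointProj_liftGraph hX z j h
  · intro h
    -- The finite partial sums of this pair lie in the closed graph, hence so does the limit `(u,
    -- v)`.
    have h2 := (hP.hasSum u).prodMk h
    exact (Submodule.isClosed_topologicalClosure _).mem_of_tendsto h2
      (.of_forall fun s => Submodule.sum_mem _ fun z _ => jointProj_mem_liftGraph hX z j u)

end Tensor

end TensorCalculus

theorem mainTheorem12 {r : ℕ} {H : Fin r → Type*} [∀ j, NormedAddCommGroup (H j)]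
    [∀ j, InnerProductSpace ℂ (H j)] [∀ j, CompleteSpace (H j)]
    (X : ∀ j, H j →ₗ.[ℂ] H j) (hX : ∀ j, TensorCalculus.IsNormalOp (X j))
    (hpp : ∀ j, TensorCalculus.HasPurePointSpectrum (X j)) (f : (Fin r → ℂ) → ℂ) :
    TensorCalculus.IsCalculus f (TensorCalculus.lifted X) (TensorCalculus.tensorCalculus f X) ∧
    (∀ F, TensorCalculus.IsCalculus f (TensorCalculus.lifted X) F →
      F = TensorCalculus.tensorCalculus f X) ∧
    (∀ E N, TensorCalculus.IsProjectorNilpotent (TensorCalculus.lifted X) E N → ∀ j, N j = 0) ∧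
    ∀ u w : TensorCalculus.HilbertTensor H,
      (u, w) ∈ (TensorCalculus.tensorCalculus f X).graph ↔
        HasSum (fun z : (∀ j, TensorCalculus.opSpectrum (X j)) =>
          f (fun j => z j) • TensorCalculus.tensorMap
            (fun j => TensorCalculus.eigenProj (X j) (z j)) u) w := by
  have hP := TensorCalculus.isResolution_jointProj hX hpp
  have hT := TensorCalculus.lifted_graph_iff hX hpp
  let p : (∀ j, TensorCalculus.opSpectrum (X j)) → Fin r → ℂ := fun z j => z j
  have hiff := hP.isCalculus_iff (p := p) hT f
  -- Existence forces the chosen branch in `tensorCalculus`; the choice is harmless because `hiff`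
  -- determines the graph.
  have hex : ∃ F, TensorCalculus.IsCalculus f (TensorCalculus.lifted X) F := by
    obtain ⟨F, hF⟩ := hP.exists_linearPMap fun z => f (p z)
    exact ⟨F, (hiff F).2 hF⟩
  have hcalc : TensorCalculus.IsCalculus f (TensorCalculus.lifted X)
      (TensorCalculus.tensorCalculus f X) := by
    rw [TensorCalculus.tensorCalculus, dif_pos hex]
    exact hex.choose_spec
  refine ⟨hcalc, fun F hF => LinearPMap.eq_of_eq_graph ?_,
    fun E N h j => hP.nilpotent_eq_zero (p := p) hT h j, (hiff _).1 hcalc⟩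
  ext ⟨u, w⟩
  rw [(hiff F).1 hF, (hiff _).1 hcalc]
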